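/- Let $K$ be a field of characteristic $0$, $\Gamma$ a finite abelian group, $H=K[\Gamma]$, and let $W=\bigoplus_{i=1}^{\theta}Kx_i$ be a quantum linear space with $x_i\in W_{g_i}^{\chi_i}$, $g_i\in\Gamma$, $\chi_i\in\widehat\Gamma$: that is, $\chi_i(g_j)\chi_j(g_i)=1$ for $i\neq j$, and $\chi_i(g_i)$ is a primitive $r_i$-th root of unity with $r_i\geq 2$. Let $A=\mathcal B(W)\#K[\Gamma]$ be the Radford biproduct of the Nichols algebra of $W$ with $H$; in it the elements of $\Gamma$ are group-like, $hx_i=\chi_i(h)x_ih$ for $h\in\Gamma$, and $\Delta(x_i)=x_i\otimes 1+g_i\otimes x_i$. Let $B=A(a_i,a_{ij}\mid 1\le i,j\le\theta)$ be an arbitrary lifting of $A$: the bialgebra generated by the group-likes $h\in\Gamma$ and by elements $x_1,\dots,x_\theta$ with $\Delta(x_i)=x_i\otimes 1+g_i\otimes x_i$, with the relations of $\Gamma$ and $$hx_i=\chi_i(h)x_ih,\qquad x_i^{r_i}=a_i(1-g_i^{r_i}),\qquad x_ix_j=\chi_j(g_i)x_jx_i+a_{ij}(1-g_ig_j)\quad(i\neq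 j),$$ where the scalars $a_i$, $a_{ij}$ ($i\ne j$) in $K$ satisfy $a_{ji}=-\chi_j(g_i)^{-1}a_{ij}$, and: if $a_i\neq0$ then $g_i^{r_i}\neq1$ and $\chi_i^{r_i}=\varepsilon$; if $a_{ij}\neq0$ then $g_ig_j\neq1$ and $\chi_i\chi_j=\varepsilon$. For $1\le s<\theta$ let $A_s$ be the subalgebra of $A$ generated by $x_1,\dots,x_s,g_1,\dots,g_s$. Then $A_s$ is spanned as a vector space by the elements $hx_1^{n_1}\cdots x_s^{n_s}$ with $h$ in the subgroup generated by $g_1,\dots,g_s$ and $0\le n_i\le r_i-1$. Let $\gamma\in Z^2_H(A,K)$, that is, $\gamma:A\otimes A\to K$ is a convolution invertible linear map such that for all $x,y,z\in A$ and $h,h'\in H$ $$\gamma(y_{(1)}\otimes z_{(1)})\,\gamma(x\otimes y_{(2)}z_{(2)})=\gamma(x_{(1)}\otimes y_{(1)})\,\gamma(x_{(2)}y_{(2)}\otimes z),$$ $$\gamma(x\otimes1)=\gamma(1\otimes x)=\varepsilon(x),\qquad \gamma(hx\otimes yh')=\varepsilon(h)\varepsilon(h')\gamma(x\otimes y).$$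 Suppose that 1. $\gamma(x_i^{n}\otimes x_i^{m})=\varepsilon(x_i^{n})\varepsilon(x_i^{m})$ for all $i$ and all $n,m\ge0$ with $n+m\le r_i-1$; 2. $\gamma(z\otimes x_s^{n})=\varepsilon(z)\varepsilon(x_s^{n})$ for all $1<s\le\theta$, all $z\in A_{s-1}$ and all $0\le n\le r_s-1$; 3. $\gamma(x_i^{r_i-1}\otimes x_i)=a_i$ for all $i$; 4. $\gamma(x_i\otimes x_j)=a_{ij}$ for all $1\le j<i\le\theta$. Let $A^\gamma$ be the bialgebra with the same coalgebra as $A$ and with multiplication the convolution product $\gamma*m_A*\gamma^{-1}$. Then $A^\gamma\cong B$ as bialgebras. -/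

import Mathlib

open scoped TensorProduct
open Coalgebra WithConv

noncomputable section

/-! ### Two-cocycles on a bialgebra and the twisted bialgebra -/

/-- Normalised two-cocycles `γ : A ⊗ A → K` on a bialgebra `A`: convolution invertible linear maps
with `γ(x ⊗ 1) = γ(1 ⊗ x) = ε(x)` and, in Sweedler notation,
`γ(y₁ ⊗ z₁) γ(x ⊗ y₂ z₂) = γ(x₁ ⊗ y₁) γ(x₂ y₂ ⊗ z)`. Here `ℛ K y` is a chosen way of writing
`Δ(y)` as a finite sum of pure tensors; the condition does not depend on the choice. -/
structure TwoCocycle (K A : Type*) [Field K] [Ring A] [Bialgebra K A] where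
  toLinearMap : A ⊗[K] A →ₗ[K] K
  isUnit : IsUnit (toConv toLinearMap)
  map_tmul_one : ∀ x : A, toLinearMap (x ⊗ₜ 1) = counit (R := K) x
  map_one_tmul : ∀ x : A, toLinearMap (1 ⊗ₜ x) = counit (R := K) x
  cocycle : ∀ x y z : A,
    (∑ j ∈ (ℛ K y).index, ∑ k ∈ (ℛ K z).index,
      toLinearMap ((ℛ K y).left j ⊗ₜ (ℛ K z).left k) *
        toLinearMap (x ⊗ₜ ((ℛ K y).right j * (ℛ K z).right k))) =
    ∑ i ∈ (ℛ K x).index, ∑ j ∈ (ℛ K y).index,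
      toLinearMap ((ℛ K x).left i ⊗ₜ (ℛ K y).left j) *
        toLinearMap (((ℛ K x).right i * (ℛ K y).right j) ⊗ₜ z)

namespace TwoCocycle

section Conv

variable {K C D E F : Type*} [Field K] [AddCommGroup C] [Module K C] [Coalgebra K C]
  [AddCommGroup D] [Module K D] [Coalgebra K D] [Ring E] [Algebra K E] [Ring F] [Algebra K F]

/-- Precomposition with a coalgebra map, as a homomorphism of convolution algebras. -/
def pull (E : Type*) [Ring E] [Algebra K E] (f : C →ₗc[K] D) :
    WithConv (D →ₗ[K] E) →* WithConv (C →ₗ[K] E) where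
  toFun u := toConv (u.ofConv ∘ₗ f.toLinearMap)
  map_one' := by ext c; simp
  map_mul' u v := by
    have := LinearMap.convMul_comp_coalgHom_distrib u v f
    exact congrArg toConv this

/-- A `K`-valued map regarded as an `E`-valued one, as a homomorphism of convolution algebras. -/
def scal (C E : Type*) [AddCommGroup C] [Module K C] [Coalgebra K C] [Ring E] [Algebra K E] :
    WithConv (C →ₗ[K] K) →* WithConv (C →ₗ[K] E) where
  toFun u := toConv (Algebra.linearMap K E ∘ₗ u.ofConv)
  map_one' := by ext c; simp
  map_mul' u v := by
    have := LinearMap.algHom_comp_convMul_distrib (Algebra.ofId K E) u v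
    exact congrArg toConv this

theorem push_scal_mul (f : E →ₗ[K] F) (u v : WithConv (C →ₗ[K] K)) (X : WithConv (C →ₗ[K] E)) :
    toConv (f ∘ₗ (scal C E u * X * scal C E v).ofConv) =
      scal C F u * toConv (f ∘ₗ X.ofConv) * scal C F v := by
  have h1 : ∀ Y : WithConv (C →ₗ[K] E), toConv (f ∘ₗ (Y * scal C E v).ofConv) =
      toConv (f ∘ₗ Y.ofConv) * scal C F v := by
    intro Y
    ext c
    change f ((Y * scal C E v) c) = (toConv (f ∘ₗ Y.ofConv) * scal C F v) c
    rw [(ℛ K c).convMul_apply, (ℛ K c).convMul_apply, map_sum]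
    refine Finset.sum_congr rfl fun i _ => ?_
    change f (_ * algebraMap K E (v _)) = f (Y _) * algebraMap K F (v _)
    rw [← Algebra.commutes, ← Algebra.smul_def, map_smul, ← Algebra.commutes, ← Algebra.smul_def]
  have h2 : toConv (f ∘ₗ (scal C E u * X).ofConv) = scal C F u * toConv (f ∘ₗ X.ofConv) := by
    ext c
    change f ((scal C E u * X) c) = (scal C F u * toConv (f ∘ₗ X.ofConv)) c
    rw [(ℛ K c).convMul_apply, (ℛ K c).convMul_apply, map_sum]
    refine Finset.sum_congr rfl fun i _ => ?_
    change f (algebraMap K E (u _) * _) = algebraMap K F (u _) * f (X _)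
    rw [← Algebra.smul_def, map_smul, ← Algebra.smul_def]
  rw [h1, h2]

end Conv

variable {K A : Type*} [Field K] [Ring A] [Bialgebra K A] (γ : TwoCocycle K A)

/-- `γ` as a unit of the convolution algebra; `γ.unit⁻¹` is the convolution inverse. -/
def unit : (WithConv (A ⊗[K] A →ₗ[K] K))ˣ := γ.isUnit.unit

theorem unit_val : (γ.unit : WithConv (A ⊗[K] A →ₗ[K] K)) = toConv γ.toLinearMap := rfl

/-- The convolution product `γ ∗ m_A ∗ γ⁻¹`. -/
def twistedMulConv : WithConv (A ⊗[K] A →ₗ[K] A) :=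
  scal _ A γ.unit.val * toConv (LinearMap.mul' K A) * scal _ A γ.unit⁻¹.val

/-- The twisted multiplication `γ ∗ m_A ∗ γ⁻¹ : A ⊗ A → A`. -/
def twistedMul : A ⊗[K] A →ₗ[K] A := γ.twistedMulConv.ofConv

theorem counit_comp_twistedMul :
    (counit (R := K) (A := A)) ∘ₗ γ.twistedMul = counit (R := K) (A := A ⊗[K] A) := by
  have h := push_scal_mul (counit (R := K) (A := A)) γ.unit.val γ.unit⁻¹.val
    (toConv (LinearMap.mul' K A))
  have h1 : (toConv (counit (R := K) (A := A) ∘ₗ LinearMap.mul' K A) :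
      WithConv (A ⊗[K] A →ₗ[K] K)) = 1 := by
    ext a b
    simp [mul_comm]
  have h2 : ∀ u : WithConv (A ⊗[K] A →ₗ[K] K), scal (A ⊗[K] A) K u = u := fun u => by
    ext a b; simp [scal]
  rw [show (toConv (LinearMap.mul' K A)).ofConv = LinearMap.mul' K A from rfl, h1, mul_one,
    h2, h2, Units.mul_inv] at h
  have := congrArg ofConv h
  refine this.trans ?_
  ext a b
  simp

theorem comul_comp_twistedMul :
    TensorProduct.map γ.twistedMul γ.twistedMul ∘ₗ comul (R := K) (A := A ⊗[K] A) =
      comul (R := K) (A := A) ∘ₗ γ.twistedMul := by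
  set u := γ.unit
  have hl := LinearMap.algHom_comp_convMul_distrib (R := K) (C := A ⊗[K] A)
    (Algebra.TensorProduct.includeLeft : A →ₐ[K] A ⊗[K] A)
  let L : A →ₗ[K] A ⊗[K] A :=
    (Algebra.TensorProduct.includeLeft : A →ₐ[K] A ⊗[K] A).toLinearMap
  let R : A →ₗ[K] A ⊗[K] A :=
    (Algebra.TensorProduct.includeRight : A →ₐ[K] A ⊗[K] A).toLinearMap
  have key : ∀ f g : A ⊗[K] A →ₗ[K] A,
      toConv (TensorProduct.map f g ∘ₗ comul (R := K) (A := A ⊗[K] A)) =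
        toConv (L ∘ₗ f) * toConv (R ∘ₗ g) := by
    intro f g
    refine WithConv.ext (LinearMap.ext fun c => ?_)
    refine Eq.trans ?_ ((ℛ K c).convMul_apply (toConv (L ∘ₗ f)) (toConv (R ∘ₗ g))).symm
    change TensorProduct.map f g (comul c) = _
    conv_lhs => rw [← (ℛ K c).eq]
    rw [map_sum]
    refine Finset.sum_congr rfl fun i _ => ?_
    change _ = (f _ ⊗ₜ[K] (1 : A)) * ((1 : A) ⊗ₜ[K] g _)
    simp
  apply toConv_injective
  rw [key]
  have e1 := push_scal_mul L u.val u⁻¹.val (toConv (LinearMap.mul' K A))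
  have e2 := push_scal_mul R u.val u⁻¹.val (toConv (LinearMap.mul' K A))
  have e3 := push_scal_mul (comul (R := K) (A := A)) u.val u⁻¹.val (toConv (LinearMap.mul' K A))
  change toConv (L ∘ₗ γ.twistedMul) = _ at e1
  change toConv (R ∘ₗ γ.twistedMul) = _ at e2
  change toConv (comul ∘ₗ γ.twistedMul) = _ at e3
  rw [e1, e2, e3]
  have hc : scal (A ⊗[K] A) (A ⊗[K] A) u⁻¹.val * scal (A ⊗[K] A) (A ⊗[K] A) u.val = 1 := by
    rw [← map_mul, Units.inv_mul, map_one]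
  have hm := key (LinearMap.mul' K A) (LinearMap.mul' K A)
  rw [show TensorProduct.map (LinearMap.mul' K A) (LinearMap.mul' K A) ∘ₗ
    comul (R := K) (A := A ⊗[K] A) = comul ∘ₗ LinearMap.mul' K A from
      (Bialgebra.mulCoalgHom K A).map_comp_comul] at hm
  change _ = scal _ _ u.val * toConv (comul ∘ₗ LinearMap.mul' K A) * _
  rw [hm]
  simp only [mul_assoc]
  rw [← mul_assoc (scal (A ⊗[K] A) (A ⊗[K] A) u⁻¹.val), hc, one_mul]

/-- The twisted multiplication is a map of coalgebras. -/
def twistedMulCoalgHom : A ⊗[K] A →ₗc[K] A where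
  toLinearMap := γ.twistedMul
  counit_comp := γ.counit_comp_twistedMul
  map_comp_comul := γ.comul_comp_twistedMul

/-- `x ↦ x ⊗ 1` as a map of coalgebras. -/
def inlCoalgHom (K A : Type*) [Field K] [Ring A] [Bialgebra K A] : A →ₗc[K] A ⊗[K] A where
  toLinearMap := (TensorProduct.mk K A A).flip 1
  counit_comp := by ext x; simp
  map_comp_comul := by
    ext x
    simp [← (ℛ K x).eq, TensorProduct.sum_tmul, Algebra.TensorProduct.one_def]

/-- `x ↦ 1 ⊗ x` as a map of coalgebras. -/
def inrCoalgHom (K A : Type*) [Field K] [Ring A] [Bialgebra K A] : A →ₗc[K] A ⊗[K] A where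
  toLinearMap := TensorProduct.mk K A A 1
  counit_comp := by ext x; simp
  map_comp_comul := by
    ext x
    simp [← (ℛ K x).eq, TensorProduct.tmul_sum, Algebra.TensorProduct.one_def]

theorem pull_twistedMulConv {C : Type*} [AddCommGroup C] [Module K C] [Coalgebra K C]
    (f : C →ₗc[K] A ⊗[K] A) :
    pull A f γ.twistedMulConv = scal _ A (pull K f γ.unit.val) *
      toConv (LinearMap.mul' K A ∘ₗ f.toLinearMap) * scal _ A (pull K f γ.unit⁻¹.val) := by
  rw [twistedMulConv, map_mul, map_mul]
  rfl

theorem twistedMul_comp_of_pull_eq_one (f : A →ₗc[K] A ⊗[K] A)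
    (hu : pull K f γ.unit.val = 1) (hm : LinearMap.mul' K A ∘ₗ f.toLinearMap = .id) (x : A) :
    γ.twistedMul (f x) = x := by
  have h := γ.pull_twistedMulConv f
  have hv : pull K f γ.unit⁻¹.val = 1 := by
    have : pull K f γ.unit.val * pull K f γ.unit⁻¹.val = 1 := by
      rw [← map_mul, Units.mul_inv, map_one]
    rwa [hu, one_mul] at this
  rw [hu, hv, hm, map_one, one_mul, mul_one] at h
  exact congrArg (fun g : WithConv (A →ₗ[K] A) => g x) h

theorem twistedMul_tmul_one (x : A) : γ.twistedMul (x ⊗ₜ 1) = x := by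
  refine γ.twistedMul_comp_of_pull_eq_one (inlCoalgHom K A) ?_ ?_ x
  · ext y
    exact γ.map_tmul_one y
  · ext y
    exact mul_one y

theorem twistedMul_one_tmul (x : A) : γ.twistedMul (1 ⊗ₜ x) = x := by
  refine γ.twistedMul_comp_of_pull_eq_one (inrCoalgHom K A) ?_ ?_ x
  · ext y
    exact γ.map_one_tmul y
  · ext y
    exact one_mul y

/-- `(x ⊗ y) ⊗ z ↦ ε(z) x ⊗ y`. -/
def dropRight (K A : Type*) [Field K] [Ring A] [Bialgebra K A] :
    (A ⊗[K] A) ⊗[K] A →ₗc[K] A ⊗[K] A :=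
  (Coalgebra.TensorProduct.rid K K (A ⊗[K] A)).toCoalgHom.comp
    (Coalgebra.TensorProduct.map (CoalgHom.id K (A ⊗[K] A)) (counitCoalgHom K A))

/-- `x ⊗ (y ⊗ z) ↦ ε(x) y ⊗ z`. -/
def dropLeft (K A : Type*) [Field K] [Ring A] [Bialgebra K A] :
    A ⊗[K] (A ⊗[K] A) →ₗc[K] A ⊗[K] A :=
  (Coalgebra.TensorProduct.lid K (A ⊗[K] A)).toCoalgHom.comp
    (Coalgebra.TensorProduct.map (counitCoalgHom K A) (CoalgHom.id K (A ⊗[K] A)))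

theorem pull_mul_right {E : Type*} [Ring E] [Algebra K E] (X : WithConv (A ⊗[K] A →ₗ[K] E)) :
    pull E (Coalgebra.TensorProduct.map γ.twistedMulCoalgHom (CoalgHom.id K A)) X =
      scal _ E (pull K (dropRight K A) γ.unit.val) *
        pull E (Coalgebra.TensorProduct.map (Bialgebra.mulCoalgHom K A) (CoalgHom.id K A)) X *
        scal _ E (pull K (dropRight K A) γ.unit⁻¹.val) := by
  have hs : ∀ w : WithConv (A ⊗[K] A →ₗ[K] K),
      scal ((A ⊗[K] A) ⊗[K] A) (A ⊗[K] A) (pull K (dropRight K A) w) =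
        toConv (TensorProduct.map (scal (A ⊗[K] A) A w).ofConv
          (1 : WithConv (A →ₗ[K] A)).ofConv) := by
    intro w
    ext x y z
    change algebraMap K (A ⊗[K] A) (w.ofConv (counit (R := K) z • (x ⊗ₜ[K] y))) =
      algebraMap K A (w.ofConv (x ⊗ₜ[K] y)) ⊗ₜ[K] algebraMap K A (counit z)
    rw [map_smul, smul_eq_mul]
    simp only [Algebra.algebraMap_eq_smul_one, Algebra.TensorProduct.one_def,
      TensorProduct.tmul_smul, ← TensorProduct.smul_tmul', smul_smul]
  have h := push_scal_mul X.ofConv (pull K (dropRight K A) γ.unit.val)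
    (pull K (dropRight K A) γ.unit⁻¹.val)
    (toConv (TensorProduct.map (LinearMap.mul' K A) (.id : A →ₗ[K] A)))
  refine Eq.trans ?_ h
  rw [hs, hs, show (toConv (TensorProduct.map (LinearMap.mul' K A) (.id : A →ₗ[K] A))) =
    toConv (TensorProduct.map (toConv (LinearMap.mul' K A)).ofConv
      (toConv (.id : A →ₗ[K] A)).ofConv) from rfl,
    TensorProduct.map_convMul_map, TensorProduct.map_convMul_map, one_mul, mul_one]
  rfl

theorem pull_mul_left {E : Type*} [Ring E] [Algebra K E] (X : WithConv (A ⊗[K] A →ₗ[K] E)) :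
    pull E (Coalgebra.TensorProduct.map (CoalgHom.id K A) γ.twistedMulCoalgHom) X =
      scal _ E (pull K (dropLeft K A) γ.unit.val) *
        pull E (Coalgebra.TensorProduct.map (CoalgHom.id K A) (Bialgebra.mulCoalgHom K A)) X *
        scal _ E (pull K (dropLeft K A) γ.unit⁻¹.val) := by
  have hs : ∀ w : WithConv (A ⊗[K] A →ₗ[K] K),
      scal (A ⊗[K] (A ⊗[K] A)) (A ⊗[K] A) (pull K (dropLeft K A) w) =
        toConv (TensorProduct.map (1 : WithConv (A →ₗ[K] A)).ofConv
          (scal (A ⊗[K] A) A w).ofConv) := by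
    intro w
    ext x y z
    change algebraMap K (A ⊗[K] A) (w.ofConv (counit (R := K) x • (y ⊗ₜ[K] z))) =
      algebraMap K A (counit x) ⊗ₜ[K] algebraMap K A (w.ofConv (y ⊗ₜ[K] z))
    rw [map_smul, smul_eq_mul, mul_comm]
    simp only [Algebra.algebraMap_eq_smul_one, Algebra.TensorProduct.one_def,
      TensorProduct.tmul_smul, ← TensorProduct.smul_tmul', smul_smul]
  have h := push_scal_mul X.ofConv (pull K (dropLeft K A) γ.unit.val)
    (pull K (dropLeft K A) γ.unit⁻¹.val)
    (toConv (TensorProduct.map (.id : A →ₗ[K] A) (LinearMap.mul' K A)))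
  refine Eq.trans ?_ h
  rw [hs, hs, show (toConv (TensorProduct.map (.id : A →ₗ[K] A) (LinearMap.mul' K A))) =
    toConv (TensorProduct.map (toConv (.id : A →ₗ[K] A)).ofConv
      (toConv (LinearMap.mul' K A)).ofConv) from rfl,
    TensorProduct.map_convMul_map, TensorProduct.map_convMul_map, one_mul, mul_one]
  rfl

theorem pull_scal {C D : Type*} [AddCommGroup C] [Module K C] [Coalgebra K C] [AddCommGroup D]
    [Module K D] [Coalgebra K D] (E : Type*) [Ring E] [Algebra K E] (f : C →ₗc[K] D)
    (w : WithConv (D →ₗ[K] K)) : pull E f (scal D E w) = scal C E (pull K f w) := rfl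

/-- The cocycle identity in the convolution algebra of `A ⊗ A ⊗ A`. -/
theorem cocycle_conv :
    pull K (Coalgebra.TensorProduct.assoc K K A A A).toCoalgHom
      (pull K (dropLeft K A) γ.unit.val *
        pull K (Coalgebra.TensorProduct.map (CoalgHom.id K A) (Bialgebra.mulCoalgHom K A))
          γ.unit.val) =
    pull K (dropRight K A) γ.unit.val *
      pull K (Coalgebra.TensorProduct.map (Bialgebra.mulCoalgHom K A) (CoalgHom.id K A))
        γ.unit.val := by
  apply WithConv.ext
  apply TensorProduct.ext_threefold
  intro x y z
  have hx : ∑ i ∈ (ℛ K x).index, counit (R := K) ((ℛ K x).left i) • (ℛ K x).right i = x :=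
    sum_counit_smul (ℛ K x)
  have hz : ∑ i ∈ (ℛ K z).index, counit (R := K) ((ℛ K z).left i) • (ℛ K z).right i = z :=
    sum_counit_smul (ℛ K z)
  refine Eq.trans (((ℛ K x).tmul ((ℛ K y).tmul (ℛ K z))).convMul_apply _ _) (Eq.trans ?_
    (((((ℛ K x).tmul (ℛ K y)).tmul (ℛ K z)).convMul_apply _ _).symm))
  have hc := γ.cocycle x y z
  refine Eq.trans ?_ (hc.trans ?_)
  · simp only [Coalgebra.Repr.tmul, Finset.sum_product, pull, dropLeft, unit_val]
    conv_rhs => rw [← hx]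
    simp only [MonoidHom.coe_mk, OneHom.coe_mk, LinearMap.comp_apply]
    simp [TensorProduct.sum_tmul, ← TensorProduct.smul_tmul', Finset.mul_sum]
    rw [Finset.sum_comm]
    refine Finset.sum_congr rfl fun j _ => ?_
    rw [Finset.sum_comm]
    refine Finset.sum_congr rfl fun k _ => Finset.sum_congr rfl fun i _ => ?_
    ring
  · simp only [Coalgebra.Repr.tmul, Finset.sum_product, pull, dropRight, unit_val]
    conv_lhs => rw [← hz]
    simp [TensorProduct.tmul_sum, TensorProduct.tmul_smul, Finset.mul_sum]
    refine Finset.sum_congr rfl fun j _ => Finset.sum_congr rfl fun k _ =>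
      Finset.sum_congr rfl fun i _ => ?_
    ring

theorem twistedMul_assoc_aux :
    pull A (Coalgebra.TensorProduct.assoc K K A A A).toCoalgHom
      (pull A (Coalgebra.TensorProduct.map (CoalgHom.id K A) γ.twistedMulCoalgHom)
          γ.twistedMulConv) =
      pull A (Coalgebra.TensorProduct.map γ.twistedMulCoalgHom (CoalgHom.id K A))
          γ.twistedMulConv := by
  set as := (Coalgebra.TensorProduct.assoc K K A A A).toCoalgHom with has
  set mr := Coalgebra.TensorProduct.map (Bialgebra.mulCoalgHom K A) (CoalgHom.id K A) with hmr
  set ml := Coalgebra.TensorProduct.map (CoalgHom.id K A) (Bialgebra.mulCoalgHom K A) with hml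
  have h1 := γ.cocycle_conv
  let P : (WithConv ((A ⊗[K] A) ⊗[K] A →ₗ[K] K))ˣ :=
    Units.map (pull K as) (Units.map (pull K (dropLeft K A)) γ.unit * Units.map (pull K ml) γ.unit)
  let Q : (WithConv ((A ⊗[K] A) ⊗[K] A →ₗ[K] K))ˣ :=
    Units.map (pull K (dropRight K A)) γ.unit * Units.map (pull K mr) γ.unit
  have hPQ : P = Q := Units.ext h1
  have hm : pull A as (pull A ml (toConv (LinearMap.mul' K A))) =
      pull A mr (toConv (LinearMap.mul' K A)) := by
    apply WithConv.ext
    apply TensorProduct.ext_threefold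
    intro x y z
    exact (mul_assoc x y z).symm
  have hl : pull A as (pull A (Coalgebra.TensorProduct.map (CoalgHom.id K A)
      γ.twistedMulCoalgHom) γ.twistedMulConv) =
      scal _ A P.val * pull A mr (toConv (LinearMap.mul' K A)) * scal _ A P⁻¹.val := by
    rw [pull_mul_left, twistedMulConv, ← hml, ← hm]
    simp only [P, map_mul, mul_inv_rev, Units.val_mul, Units.coe_map, Units.coe_map_inv,
      pull_scal, mul_assoc]
  have hr : pull A (Coalgebra.TensorProduct.map γ.twistedMulCoalgHom (CoalgHom.id K A))
          γ.twistedMulConv =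
      scal _ A Q.val * pull A mr (toConv (LinearMap.mul' K A)) * scal _ A Q⁻¹.val := by
    rw [pull_mul_right, twistedMulConv, ← hmr]
    simp only [Q, map_mul, mul_inv_rev, Units.val_mul, Units.coe_map, Units.coe_map_inv,
      pull_scal, mul_assoc]
  rw [hl, hr, hPQ]

theorem twistedMul_assoc (x y z : A) :
    γ.twistedMul (γ.twistedMul (x ⊗ₜ y) ⊗ₜ z) = γ.twistedMul (x ⊗ₜ γ.twistedMul (y ⊗ₜ z)) :=
  (congrArg (fun g : WithConv ((A ⊗[K] A) ⊗[K] A →ₗ[K] A) => g ((x ⊗ₜ y) ⊗ₜ z))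
    γ.twistedMul_assoc_aux).symm

/-- The underlying space of the twisted bialgebra `A^γ`: the coalgebra `A`, with multiplication
`γ ∗ m_A ∗ γ⁻¹`. -/
def Twist (_γ : TwoCocycle K A) : Type _ := A

instance : AddCommGroup γ.Twist := inferInstanceAs (AddCommGroup A)

instance : Module K γ.Twist := inferInstanceAs (Module K A)

instance : Coalgebra K γ.Twist := inferInstanceAs (Coalgebra K A)

/-- The identity map `A → A^γ`, an isomorphism of coalgebras. -/
def toTwist : A ≃ₗc[K] γ.Twist := CoalgEquiv.refl K A

instance : Ring γ.Twist where
  __ := (inferInstance : AddCommGroup γ.Twist)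
  mul x y := γ.toTwist (γ.twistedMul (γ.toTwist.symm x ⊗ₜ γ.toTwist.symm y))
  one := γ.toTwist 1
  zero_mul x := LinearMap.map_zero₂ (TensorProduct.curry γ.twistedMul) x
  mul_zero x := LinearMap.map_zero (TensorProduct.curry γ.twistedMul x)
  left_distrib x y z := LinearMap.map_add (TensorProduct.curry γ.twistedMul x) y z
  right_distrib x y z := LinearMap.map_add₂ (TensorProduct.curry γ.twistedMul) x y z
  mul_assoc := γ.twistedMul_assoc
  one_mul := γ.twistedMul_one_tmul
  mul_one := γ.twistedMul_tmul_one

theorem toTwist_mul_toTwist (x y : A) :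
    γ.toTwist x * γ.toTwist y = γ.toTwist (γ.twistedMul (x ⊗ₜ y)) := rfl

theorem toTwist_one : γ.toTwist 1 = 1 := rfl

instance : Algebra K γ.Twist :=
  Algebra.ofModule
    (fun c x y => LinearMap.map_smul₂ (TensorProduct.curry γ.twistedMul) c x y)
    (fun c x y => LinearMap.map_smul (TensorProduct.curry γ.twistedMul x) c y)

theorem mul'_twist : (LinearMap.mul' K γ.Twist : γ.Twist ⊗[K] γ.Twist →ₗ[K] γ.Twist) =
    (show A ⊗[K] A →ₗ[K] A from γ.twistedMul) := by
  apply TensorProduct.ext'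
  intro x y
  rfl

theorem twist_comul_mul (x y : γ.Twist) :
    comul (R := K) (x * y) = comul (R := K) x * comul (R := K) y := by
  have h : ∀ a b : γ.Twist ⊗[K] γ.Twist, a * b =
      TensorProduct.map (LinearMap.mul' K γ.Twist) (LinearMap.mul' K γ.Twist)
        (TensorProduct.tensorTensorTensorComm K _ _ _ _ (a ⊗ₜ b)) := fun a b =>
    LinearMap.congr_fun (LinearMap.mul'_tensor (R := K) (A := γ.Twist) (B := γ.Twist)) (a ⊗ₜ[K] b)
  rw [h, mul'_twist]
  exact (congrArg (fun f => f (x ⊗ₜ[K] y)) γ.comul_comp_twistedMul).symm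

instance : Bialgebra K γ.Twist :=
  Bialgebra.mk' K γ.Twist (Bialgebra.counit_one (R := K) (A := A))
    (fun {x y} =>
      congrArg (fun f => f (x ⊗ₜ[K] y)) γ.counit_comp_twistedMul |>.trans (mul_comm _ _))
    (Bialgebra.comul_one (R := K) (A := A))
    (fun {x y} => γ.twist_comul_mul x y)

/-- `γ` is bilinear over the subalgebra `H`: `γ(h a ⊗ b h') = ε(h) ε(h') γ(a ⊗ b)`. -/
def IsBilinearOver (H : Subalgebra K A) : Prop :=
  ∀ h ∈ H, ∀ h' ∈ H, ∀ a b : A,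
    γ.toLinearMap ((h * a) ⊗ₜ (b * h')) =
      counit (R := K) h * counit (R := K) h' * γ.toLinearMap (a ⊗ₜ b)

end TwoCocycle

/-! ### The quantum binomial formula -/

/-- Gaussian binomial coefficients. -/
def qBinom {K : Type*} [Field K] (q : K) : ℕ → ℕ → K
  | _, 0 => 1
  | 0, _ + 1 => 0
  | n + 1, k + 1 => qBinom q n k + q ^ (k + 1) * qBinom q n (k + 1)

theorem qBinom_zero {K : Type*} [Field K] (q : K) (n : ℕ) : qBinom q n 0 = 1 := by
  cases n <;> rfl

theorem qBinom_eq_zero {K : Type*} [Field K] (q : K) (n k : ℕ) (h : n < k) : qBinom q n k = 0 := by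
  induction n generalizing k with
  | zero =>
    cases k with
    | zero => omega
    | succ k => rfl
  | succ n ih =>
    cases k with
    | zero => omega
    | succ k => rw [qBinom, ih k (by omega), ih (k + 1) (by omega)]; ring

theorem qBinom_self {K : Type*} [Field K] (q : K) (n : ℕ) : qBinom q n n = 1 := by
  induction n with
  | zero => rfl
  | succ n ih => rw [qBinom, ih, qBinom_eq_zero q n (n + 1) (by omega)]; ring

theorem qBinom_mul {K : Type*} [Field K] (q : K) (n k : ℕ) :
    qBinom q n (k + 1) * (q ^ (k + 1) - 1) * q ^ k = qBinom q n k * (q ^ n - q ^ k) := by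
  induction n generalizing k with
  | zero =>
    cases k with
    | zero => simp [qBinom]
    | succ k => simp [qBinom]
  | succ n ih =>
    cases k with
    | zero =>
      have := ih 0
      simp only [qBinom, qBinom_zero] at this ⊢
      linear_combination q * this
    | succ k =>
      have h1 := ih (k + 1)
      have h2 := ih k
      simp only [qBinom] at h1 h2 ⊢
      linear_combination q ^ (k + 2) * h1 + q * h2

theorem qBinom_eq_zero_of_isPrimitiveRoot {K : Type*} [Field K] {q : K} {r : ℕ}
    (hq : IsPrimitiveRoot q r) (k : ℕ) (hk : k + 1 < r) : qBinom q r (k + 1) = 0 := by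
  have hq0 : q ≠ 0 := hq.ne_zero (by omega)
  have h1 : q ^ (k + 1) - 1 ≠ 0 :=
    sub_ne_zero.mpr (hq.pow_ne_one_of_pos_of_lt (by omega) hk)
  have h := qBinom_mul q r k
  have h2 : qBinom q r k * (q ^ r - q ^ k) = 0 := by
    cases k with
    | zero => simp [hq.pow_eq_one]
    | succ j => rw [qBinom_eq_zero_of_isPrimitiveRoot hq j (by omega), zero_mul]
  rw [h2] at h
  simpa [h1, hq0] using h

theorem add_pow_eq_sum_qBinom {K T : Type*} [Field K] [Ring T] [Algebra K T] (q : K) (X Y : T)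
    (h : Y * X = q • (X * Y)) (n : ℕ) :
    (X + Y) ^ n = ∑ k ∈ Finset.range (n + 1), qBinom q n k • (X ^ k * Y ^ (n - k)) := by
  have hc : ∀ k, Y * X ^ k = q ^ k • (X ^ k * Y) := by
    intro k
    induction k with
    | zero => simp
    | succ k ih =>
      rw [pow_succ X, ← mul_assoc, ih, smul_mul_assoc, mul_assoc, h, mul_smul_comm, smul_smul,
        ← mul_assoc, pow_succ]
  induction n with
  | zero => simp [qBinom]
  | succ n ih =>
    have e1 : Y * ∑ k ∈ Finset.range (n + 1), qBinom q n k • (X ^ k * Y ^ (n - k)) =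
        ∑ k ∈ Finset.range (n + 2), (q ^ k * qBinom q n k) • (X ^ k * Y ^ (n + 1 - k)) := by
      rw [Finset.sum_range_succ _ (n + 1), qBinom_eq_zero q n (n + 1) (by omega), mul_zero,
        zero_smul, add_zero, Finset.mul_sum]
      refine Finset.sum_congr rfl fun k hk => ?_
      have hk' : k ≤ n := by simpa [Nat.lt_succ_iff] using hk
      rw [mul_smul_comm, ← mul_assoc, hc, smul_mul_assoc, smul_smul, mul_assoc, ← pow_succ',
        mul_comm, Nat.sub_add_comm hk']
    have e2 : X * ∑ k ∈ Finset.range (n + 1), qBinom q n k • (X ^ k * Y ^ (n - k)) =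
        ∑ k ∈ Finset.range (n + 1), qBinom q n k • (X ^ (k + 1) * Y ^ (n + 1 - (k + 1))) := by
      rw [Finset.mul_sum]
      refine Finset.sum_congr rfl fun k _ => ?_
      rw [mul_smul_comm, ← mul_assoc, ← pow_succ', Nat.add_sub_add_right]
    rw [pow_succ', ih, add_mul, e1, e2, Finset.sum_range_succ' _ (n + 1),
      Finset.sum_range_succ' _ (n + 1), ← add_assoc, ← Finset.sum_add_distrib]
    congr 1
    · refine Finset.sum_congr rfl fun k _ => ?_
      rw [← add_smul, qBinom]
    · simp [qBinom_zero]

theorem add_pow_eq_of_isPrimitiveRoot {K T : Type*} [Field K] [Ring T] [Algebra K T] {q : K}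
    {r : ℕ} (hq : IsPrimitiveRoot q r) (hr : 2 ≤ r) (X Y : T) (h : Y * X = q • (X * Y)) :
    (X + Y) ^ r = X ^ r + Y ^ r := by
  obtain ⟨s, rfl⟩ : ∃ s, r = s + 1 := ⟨r - 1, by omega⟩
  rw [add_pow_eq_sum_qBinom q X Y h, Finset.sum_range_succ, Finset.sum_range_succ',
    Finset.sum_eq_zero, qBinom_self, qBinom_zero]
  · simp [add_comm]
  · intro k hk
    rw [qBinom_eq_zero_of_isPrimitiveRoot hq k (by simpa using hk), zero_smul]

/-! ### Quantum linear spaces and the associated Hopf algebras -/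

/-- The data of a quantum linear space `W = ⊕ K xᵢ` of rank `θ` over a group `Γ`: group elements
`gᵢ` and characters `χᵢ` such that `xᵢ ∈ W_{gᵢ}^{χᵢ}`, subject to the two conditions
`χᵢ(gⱼ) χⱼ(gᵢ) = 1` for `i ≠ j` and `χᵢ(gᵢ)` a primitive `rᵢ`-th root of unity, `rᵢ ≥ 2`. -/
structure QuantumLinearSpace (K Γ : Type*) [Field K] [CommGroup Γ] (θ : ℕ) where
  g : Fin θ → Γ
  χ : Fin θ → Γ →* Kˣ
  r : Fin θ → ℕ
  two_le_r : ∀ i, 2 ≤ r i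
  χ_mul_χ : ∀ i j, i ≠ j → χ i (g j) * χ j (g i) = 1
  isPrimitiveRoot : ∀ i, IsPrimitiveRoot (χ i (g i) : K) (r i)

namespace QuantumLinearSpace

variable {K Γ : Type*} [Field K] [CommGroup Γ] {θ : ℕ} (D : QuantumLinearSpace K Γ θ)

/-- The defining relations of `T(W) # K[Γ]` on generators `h ∈ Γ` and `x₁, …, x_θ`: the
multiplication table of `Γ`, and `h xᵢ = χᵢ(h) xᵢ h`. -/
inductive TensorRel : FreeAlgebra K (Γ ⊕ Fin θ) → FreeAlgebra K (Γ ⊕ Fin θ) → Prop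
  | one : TensorRel (FreeAlgebra.ι K (Sum.inl 1)) 1
  | mul (h k : Γ) : TensorRel (FreeAlgebra.ι K (Sum.inl (h * k)))
      (FreeAlgebra.ι K (Sum.inl h) * FreeAlgebra.ι K (Sum.inl k))
  | comm (h : Γ) (i : Fin θ) :
      TensorRel (FreeAlgebra.ι K (Sum.inl h) * FreeAlgebra.ι K (Sum.inr i))
        ((D.χ i h : K) • (FreeAlgebra.ι K (Sum.inr i) * FreeAlgebra.ι K (Sum.inl h)))

/-- The biproduct `T(W) # K[Γ]` of the tensor algebra of `W` with the group algebra of `Γ`. -/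
def TensorBiproduct : Type _ := RingQuot D.TensorRel

instance : Ring D.TensorBiproduct := inferInstanceAs (Ring (RingQuot D.TensorRel))

instance : Algebra K D.TensorBiproduct := inferInstanceAs (Algebra K (RingQuot D.TensorRel))

namespace TensorBiproduct

/-- The quotient map from the free algebra. -/
def mk : FreeAlgebra K (Γ ⊕ Fin θ) →ₐ[K] D.TensorBiproduct := RingQuot.mkAlgHom K D.TensorRel

/-- The group element `h ∈ Γ` in `T(W) # K[Γ]`. -/
def grp (h : Γ) : D.TensorBiproduct := mk D (FreeAlgebra.ι K (Sum.inl h))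

/-- The generator `xᵢ` in `T(W) # K[Γ]`. -/
def x (i : Fin θ) : D.TensorBiproduct := mk D (FreeAlgebra.ι K (Sum.inr i))

theorem grp_one : grp D 1 = 1 :=
  (RingQuot.mkAlgHom_rel K (TensorRel.one (D := D))).trans (map_one _)

theorem grp_mul (h k : Γ) : grp D (h * k) = grp D h * grp D k :=
  (RingQuot.mkAlgHom_rel K (TensorRel.mul (D := D) h k)).trans (map_mul _ _ _)

theorem grp_mul_x (h : Γ) (i : Fin θ) : grp D h * x D i = (D.χ i h : K) • (x D i * grp D h) := by
  have := RingQuot.mkAlgHom_rel K (TensorRel.comm (D := D) h i)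
  rw [map_mul, map_smul, map_mul] at this
  exact this

variable {D}

theorem algHom_ext {B : Type*} [Semiring B] [Algebra K B] {f f' : D.TensorBiproduct →ₐ[K] B}
    (hg : ∀ h, f (grp D h) = f' (grp D h)) (hx : ∀ i, f (x D i) = f' (x D i)) : f = f' := by
  apply RingQuot.ringQuot_ext'
  apply FreeAlgebra.hom_ext
  funext s
  cases s with
  | inl h => exact hg h
  | inr i => exact hx i

/-- The universal property of the presentation. -/
def lift {B : Type*} [Semiring B] [Algebra K B] (G : Γ → B) (X : Fin θ → B) (h1 : G 1 = 1)
    (hm : ∀ h k, G (h * k) = G h * G k)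
    (hc : ∀ h i, G h * X i = (D.χ i h : K) • (X i * G h)) : D.TensorBiproduct →ₐ[K] B :=
  RingQuot.liftAlgHom K ⟨FreeAlgebra.lift K (Sum.elim G X), by
    intro a b hab
    cases hab with
    | one => simpa using h1
    | mul h k => simpa using hm h k
    | comm h i => simpa using hc h i⟩

theorem lift_grp {B : Type*} [Semiring B] [Algebra K B] (G : Γ → B) (X : Fin θ → B) (h1 hm hc)
    (h : Γ) : lift (D := D) G X h1 hm hc (grp D h) = G h :=
  (RingQuot.liftAlgHom_mkAlgHom_apply K _ _ _).trans (by simp)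

theorem lift_x {B : Type*} [Semiring B] [Algebra K B] (G : Γ → B) (X : Fin θ → B) (h1 hm hc)
    (i : Fin θ) : lift (D := D) G X h1 hm hc (x D i) = X i :=
  (RingQuot.liftAlgHom_mkAlgHom_apply K _ _ _).trans (by simp)

variable (D)

theorem comul_aux_one : grp D 1 ⊗ₜ[K] grp D 1 = 1 := by
  rw [grp_one]; rfl

theorem comul_aux_mul (h k : Γ) :
    grp D (h * k) ⊗ₜ[K] grp D (h * k) = grp D h ⊗ₜ[K] grp D h * grp D k ⊗ₜ[K] grp D k := by
  rw [Algebra.TensorProduct.tmul_mul_tmul, grp_mul]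

theorem comul_aux_comm (h : Γ) (i : Fin θ) :
    grp D h ⊗ₜ[K] grp D h * (x D i ⊗ₜ[K] 1 + grp D (D.g i) ⊗ₜ[K] x D i) =
      (D.χ i h : K) •
        ((x D i ⊗ₜ[K] 1 + grp D (D.g i) ⊗ₜ[K] x D i) * grp D h ⊗ₜ[K] grp D h) := by
  simp only [mul_add, add_mul, Algebra.TensorProduct.tmul_mul_tmul, grp_mul_x, mul_one, one_mul,
    ← grp_mul, mul_comm h, smul_add, TensorProduct.smul_tmul', TensorProduct.tmul_smul]

/-- The comultiplication: `Δ(h) = h ⊗ h` and `Δ(xᵢ) = xᵢ ⊗ 1 + gᵢ ⊗ xᵢ`. -/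
def comulHom : D.TensorBiproduct →ₐ[K] D.TensorBiproduct ⊗[K] D.TensorBiproduct :=
  lift (fun h => grp D h ⊗ₜ grp D h) (fun i => x D i ⊗ₜ 1 + grp D (D.g i) ⊗ₜ x D i)
    (comul_aux_one D) (comul_aux_mul D) (comul_aux_comm D)

/-- The counit: `ε(h) = 1` and `ε(xᵢ) = 0`. -/
def counitHom : D.TensorBiproduct →ₐ[K] K :=
  lift (fun _ => 1) (fun _ => 0) rfl (fun _ _ => by simp) (fun _ _ => by simp)

theorem comulHom_grp (h : Γ) : comulHom D (grp D h) = grp D h ⊗ₜ[K] grp D h := by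
  rw [comulHom, lift_grp]

theorem comulHom_x (i : Fin θ) :
    comulHom D (x D i) = x D i ⊗ₜ[K] 1 + grp D (D.g i) ⊗ₜ[K] x D i := by
  rw [comulHom, lift_x]

theorem counitHom_grp (h : Γ) : counitHom D (grp D h) = 1 := by
  rw [counitHom, lift_grp]

theorem counitHom_x (i : Fin θ) : counitHom D (x D i) = 0 := by
  rw [counitHom, lift_x]

instance : Bialgebra K D.TensorBiproduct :=
  Bialgebra.ofAlgHom (comulHom D) (counitHom D)
    (algHom_ext
      (fun h => by simp [comulHom_grp])
      (fun i => by
        simp [comulHom_grp, comulHom_x, TensorProduct.add_tmul, TensorProduct.tmul_add,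
          Algebra.TensorProduct.one_def, add_assoc]))
    (algHom_ext
      (fun h => by simp [comulHom_grp, counitHom_grp])
      (fun i => by simp [comulHom_x, counitHom_grp, counitHom_x]))
    (algHom_ext
      (fun h => by simp [comulHom_grp, counitHom_grp])
      (fun i => by simp [comulHom_x, counitHom_x]))

theorem comul_grp (h : Γ) : comul (R := K) (grp D h) = grp D h ⊗ₜ[K] grp D h :=
  comulHom_grp D h

theorem comul_x (i : Fin θ) :
    comul (R := K) (x D i) = x D i ⊗ₜ[K] 1 + grp D (D.g i) ⊗ₜ[K] x D i :=
  comulHom_x D i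

theorem counit_grp (h : Γ) : counit (R := K) (grp D h) = 1 := counitHom_grp D h

theorem counit_x (i : Fin θ) : counit (R := K) (x D i) = 0 := counitHom_x D i

end TensorBiproduct

open TensorBiproduct

/-- The part `⊕_{n ≥ 2} T^n(W) # K[Γ]` of `T(W) # K[Γ]`. -/
def degreeGeTwo : Submodule K D.TensorBiproduct :=
  Submodule.span K {t | ∃ (l : List (Fin θ)) (h : Γ), 2 ≤ l.length ∧
    t = (l.map (x D)).prod * grp D h}

/-- The defining ideal of `B(W) # K[Γ]`, where `B(W)` is the Nichols algebra of `W`: the largest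
two-sided ideal and coideal of `T(W) # K[Γ]` contained in `⊕_{n ≥ 2} T^n(W) # K[Γ]`. -/
def nicholsIdeal : Ideal D.TensorBiproduct :=
  sSup {I | I.IsTwoSided ∧ (I.restrictScalars K).IsCoideal ∧
    I.restrictScalars K ≤ D.degreeGeTwo}

instance : D.nicholsIdeal.IsTwoSided where
  mul_mem_of_left {a} b ha := by
    have h : D.nicholsIdeal ≤ Submodule.comap
        (LinearMap.toSpanSingleton D.TensorBiproduct D.TensorBiproduct b) D.nicholsIdeal := by
      refine sSup_le fun I hI y hy => ?_
      exact le_sSup (a := I) hI (hI.1.mul_mem_of_left b hy)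
    exact h ha

instance : (D.nicholsIdeal.restrictScalars K).IsCoideal where
  counit_eq_zero t ht := by
    have h : D.nicholsIdeal ≤ RingHom.ker (Bialgebra.counitAlgHom K D.TensorBiproduct) :=
      sSup_le fun I hI y hy => hI.2.1.counit_eq_zero hy
    exact h ht
  map_mkQ_comul_eq_zero t ht := by
    let π := Ideal.Quotient.mkₐ K D.nicholsIdeal
    have h : D.nicholsIdeal ≤ RingHom.ker ((Algebra.TensorProduct.map π π).comp
        (Bialgebra.comulAlgHom K D.TensorBiproduct)) := by
      refine sSup_le fun I hI y hy => ?_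
      have h1 := hI.2.1.map_mkQ_comul_eq_zero hy
      have hle : I.restrictScalars K ≤ D.nicholsIdeal.restrictScalars K := le_sSup (a := I) hI
      let f := (I.restrictScalars K).mapQ (D.nicholsIdeal.restrictScalars K) .id hle
      have h2 := congrArg (TensorProduct.map f f) h1
      rw [← LinearMap.comp_apply, ← TensorProduct.map_comp, map_zero] at h2
      exact h2
    exact h ht

/-- The Radford biproduct `A = B(W) # K[Γ]` of the Nichols algebra of `W` with `K[Γ]`. -/
abbrev Biproduct : Type _ := D.TensorBiproduct ⧸ D.nicholsIdeal

namespace Biproduct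

/-- The group element `h ∈ Γ` in `A`. -/
def grp (h : Γ) : D.Biproduct := Ideal.Quotient.mk _ (TensorBiproduct.grp D h)

/-- The generator `xᵢ` of `A`. -/
def x (i : Fin θ) : D.Biproduct := Ideal.Quotient.mk _ (TensorBiproduct.x D i)

/-- The sub-Hopf algebra `H = K[Γ]` of `A`, generated by the group elements. -/
def groupSubalgebra : Subalgebra K D.Biproduct := Algebra.adjoin K (Set.range (grp D))

/-- The subalgebra `A_s` of `A` generated by `x₁, …, x_s, g₁, …, g_s`. -/
def initialSubalgebra (s : ℕ) : Subalgebra K D.Biproduct :=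
  Algebra.adjoin K {t | ∃ j : Fin θ, j.val < s ∧ (t = x D j ∨ t = grp D (D.g j))}

/-- The monomial `x₁^{n₁} ⋯ x_θ^{n_θ}` of `A`. -/
def monomial (n : Fin θ → ℕ) : D.Biproduct := (List.ofFn fun j => x D j ^ n j).prod

end Biproduct

/-- Scalars `aᵢ` and `aᵢⱼ` (`i ≠ j`) defining a lifting of `B(W) # K[Γ]`. The value of `b i i` is
irrelevant. -/
structure LiftingScalars where
  a : Fin θ → K
  b : Fin θ → Fin θ → K
  b_symm : ∀ i j, i ≠ j → b j i = -((D.χ j (D.g i) : K)⁻¹ * b i j)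
  g_pow_ne_one : ∀ i, a i ≠ 0 → D.g i ^ D.r i ≠ 1
  χ_pow_eq_one : ∀ i, a i ≠ 0 → D.χ i ^ D.r i = 1
  g_mul_g_ne_one : ∀ i j, i ≠ j → b i j ≠ 0 → D.g i * D.g j ≠ 1
  χ_mul_χ_eq_one : ∀ i j, i ≠ j → b i j ≠ 0 → D.χ i * D.χ j = 1

namespace LiftingScalars

variable {D} (S : D.LiftingScalars)

/-- The relations `xᵢ^{rᵢ} = aᵢ (1 - gᵢ^{rᵢ})` and `xᵢ xⱼ = χⱼ(gᵢ) xⱼ xᵢ + aᵢⱼ (1 - gᵢ gⱼ)`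
for `i ≠ j`, written as elements of `T(W) # K[Γ]` that are to vanish. -/
inductive Relator : D.TensorBiproduct → Prop
  | power (i : Fin θ) : Relator (x D i ^ D.r i - S.a i • (1 - grp D (D.g i ^ D.r i)))
  | link (i j : Fin θ) (h : i ≠ j) : Relator (x D i * x D j -
      ((D.χ j (D.g i) : K) • (x D j * x D i) + S.b i j • (1 - grp D (D.g i * D.g j))))

/-- The two-sided ideal generated by the relations of the lifting. -/
def ideal : Ideal D.TensorBiproduct := (TwoSidedIdeal.span {t | S.Relator t}).asIdeal

instance : S.ideal.IsTwoSided := inferInstanceAs (TwoSidedIdeal.asIdeal _).IsTwoSided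

theorem relator_mem {t : D.TensorBiproduct} (h : S.Relator t) : t ∈ S.ideal :=
  TwoSidedIdeal.mem_asIdeal.mpr (TwoSidedIdeal.subset_span h)

theorem counit_relator {t : D.TensorBiproduct} (h : S.Relator t) : counit (R := K) t = 0 := by
  cases h with
  | power i =>
    have := D.two_le_r i
    simp [counit_grp, counit_x, zero_pow (show D.r i ≠ 0 by omega)]
  | link i j h => simp [counit_grp, counit_x]

/-- Each relator `t` is skew primitive: `Δ(t) = t ⊗ 1 + h ⊗ t` with `h ∈ Γ`. -/
theorem comul_relator {t : D.TensorBiproduct} (h : S.Relator t) :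
    ∃ k : Γ, comul (R := K) t = t ⊗ₜ[K] 1 + grp D k ⊗ₜ[K] t := by
  cases h with
  | power i =>
    refine ⟨D.g i ^ D.r i, ?_⟩
    have hg : ∀ n : ℕ, grp D (D.g i) ^ n = grp D (D.g i ^ n) := by
      intro n
      induction n with
      | zero => simp [grp_one]
      | succ n ih => rw [pow_succ, ih, ← grp_mul, ← pow_succ]
    have h1 := add_pow_eq_of_isPrimitiveRoot (D.isPrimitiveRoot i) (D.two_le_r i)
      (x D i ⊗ₜ[K] (1 : D.TensorBiproduct)) (grp D (D.g i) ⊗ₜ[K] x D i) (by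
        simp only [Algebra.TensorProduct.tmul_mul_tmul, mul_one, one_mul, grp_mul_x,
          TensorProduct.smul_tmul'])
    rw [Algebra.TensorProduct.tmul_pow, Algebra.TensorProduct.tmul_pow, one_pow, hg] at h1
    rw [map_sub, map_smul, map_sub, Bialgebra.comul_pow, comul_x, h1, Bialgebra.comul_one,
      comul_grp, Algebra.TensorProduct.one_def]
    simp only [TensorProduct.sub_tmul, TensorProduct.tmul_sub, TensorProduct.tmul_smul,
      ← TensorProduct.smul_tmul', smul_sub]
    abel
  | link i j h =>
    refine ⟨D.g i * D.g j, ?_⟩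
    have hχ : (D.χ j (D.g i) : K) * (D.χ i (D.g j) : K) = 1 := by
      have := congrArg Units.val (D.χ_mul_χ i j h)
      rw [mul_comm]
      simpa using this
    rw [map_sub, map_add, map_smul, map_smul, map_sub, Bialgebra.comul_mul, Bialgebra.comul_mul,
      comul_x, comul_x, Bialgebra.comul_one, comul_grp, Algebra.TensorProduct.one_def]
    simp only [mul_add, add_mul, Algebra.TensorProduct.tmul_mul_tmul, mul_one, one_mul, grp_mul_x,
      ← grp_mul, mul_comm (D.g j) (D.g i), TensorProduct.sub_tmul, TensorProduct.tmul_sub,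
      TensorProduct.add_tmul, TensorProduct.tmul_add, TensorProduct.tmul_smul,
      ← TensorProduct.smul_tmul', smul_sub, smul_add, smul_smul, hχ, one_smul]
    abel

theorem ideal_le_ker {B : Type*} [Ring B] [Algebra K B] (f : D.TensorBiproduct →ₐ[K] B)
    (hf : ∀ t, S.Relator t → f t = 0) : ∀ t ∈ S.ideal, f t = 0 := by
  intro t ht
  have h : TwoSidedIdeal.span {t | S.Relator t} ≤ TwoSidedIdeal.ker f :=
    TwoSidedIdeal.span_le.mpr fun t ht => (TwoSidedIdeal.mem_ker f).mpr (hf t ht)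
  exact (TwoSidedIdeal.mem_ker f).mp (h (TwoSidedIdeal.mem_asIdeal.mp ht))

instance : (S.ideal.restrictScalars K).IsCoideal where
  counit_eq_zero t ht := S.ideal_le_ker (Bialgebra.counitAlgHom K D.TensorBiproduct)
    (fun _ h => S.counit_relator h) t ht
  map_mkQ_comul_eq_zero t ht := by
    let π := Ideal.Quotient.mkₐ K S.ideal
    refine S.ideal_le_ker ((Algebra.TensorProduct.map π π).comp
      (Bialgebra.comulAlgHom K D.TensorBiproduct)) (fun t h => ?_) t ht
    obtain ⟨k, hk⟩ := S.comul_relator h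
    have hπ : π t = 0 := Ideal.Quotient.eq_zero_iff_mem.mpr (S.relator_mem h)
    simp [hk, hπ]

/-- The lifting `B = A(aᵢ, aᵢⱼ)` of `B(W) # K[Γ]`: the quotient of `T(W) # K[Γ]` by the relations
of the lifting, that is, the algebra generated by `Γ` and `x₁, …, x_θ` with relations those of `Γ`,
`h xᵢ = χᵢ(h) xᵢ h`, `xᵢ^{rᵢ} = aᵢ (1 - gᵢ^{rᵢ})` and
`xᵢ xⱼ = χⱼ(gᵢ) xⱼ xᵢ + aᵢⱼ (1 - gᵢ gⱼ)` for `i ≠ j`, with group-like `h ∈ Γ` and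
`Δ(xᵢ) = xᵢ ⊗ 1 + gᵢ ⊗ xᵢ`. -/
abbrev Lifting : Type _ := D.TensorBiproduct ⧸ S.ideal

end LiftingScalars

end QuantumLinearSpace

end

/-! Right multiplication in `A^γ` by a skew primitive `x` with `Δ(x) = x ⊗ 1 + g ⊗ x` differs from
that in `A` by two explicit corrections: `y · x = yx + γ(y₁ ⊗ x) y₂ - γ(y₂ ⊗ x) y₁ g`
(`twistedMul_tmul_skewPrimitive`). Bilinearity over `K[Γ]` makes twisted products by group elements
untwisted, so the generators of `A` induce an algebra map `toTwistHom` from `T(W) # K[Γ]` to `A^γ`.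

The lifting relations hold there (`toTwistHom_relator`). For `i ≠ j` the formula reads `x_i · x_j =
x_i x_j + γ(x_i ⊗ x_j)(1 - g_i g_j)`; the value of `γ` is `0` or `a_{ij}` according to the order of
`i` and `j`, and the symmetry of the `a_{ij}` covers both orders. For powers, the quantum binomial
formula for `Δ(x_i^n)` shows that no correction appears before exponent `r_i`, where only the two
extreme terms survive and give `a_i (1 - g_i^{r_i})`. Hence `B` maps to `A^γ` by a bialgebra map.

This map is onto: `y x_i` equals `y · x_i` up to shorter words, so induction on length applies
(`toTwist_mem_range`). It is injective by dimension. Straightening bounds `dim B` above by `|Γ| ∏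
r_i` (`span_lifting_eq_top`), and the ordered monomials are linearly independent in `A`
(`linearIndependent_monomial`). The Nichols ideal being defined by maximality, independence is
proved with skew derivations: `Δ` composed with a 2×2 representation killing products of two
generators. Straightening in `A` also gives the spanning set of `A_s`. -/

noncomputable section

namespace TwoCocycle

variable {K A : Type*} [Field K] [Ring A] [Bialgebra K A]

/-! ### Twisted multiplication by a skew primitive element -/

theorem sum_counit_left_smul_apply {E : Type*} [AddCommGroup E] [Module K E] (F : A →ₗ[K] E)
    (y : A) :
    ∑ j ∈ (ℛ K y).index, counit (R := K) ((ℛ K y).left j) • F ((ℛ K y).right j) = F y := by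
  simp only [← map_smul, ← map_sum]
  rw [sum_counit_smul]

theorem sum_counit_right_smul_apply {E : Type*} [AddCommGroup E] [Module K E] (F : A →ₗ[K] E)
    (y : A) :
    ∑ j ∈ (ℛ K y).index, counit (R := K) ((ℛ K y).right j) • F ((ℛ K y).left j) = F y := by
  have := congrArg (TensorProduct.rid K A) (sum_tmul_counit_eq (ℛ K y))
  simp only [map_sum, TensorProduct.rid_tmul, one_smul] at this
  simp only [← map_smul, ← map_sum]
  rw [this]

/-- A convolution product can be evaluated with any representative of `Δ`. A one-term representative
is used for a group-like, a two-term one for a skew primitive, so that only the sum over `Δ(y)`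
remains. -/
theorem convMul_tmul_grouplike {E : Type*} [Ring E] [Algebra K E]
    (X Y : WithConv (A ⊗[K] A →ₗ[K] E)) {g : A} (hg : comul (R := K) g = g ⊗ₜ[K] g) (y : A) :
    (X * Y) (y ⊗ₜ g) =
      ∑ j ∈ (ℛ K y).index, X ((ℛ K y).left j ⊗ₜ g) * Y ((ℛ K y).right j ⊗ₜ g) := by
  let R : Coalgebra.Repr K g Unit := ⟨{()}, fun _ => g, fun _ => g, by simp [hg]⟩
  rw [((ℛ K y).tmul R).convMul_apply]
  simp [Coalgebra.Repr.tmul, R]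

theorem convMul_tmul_skewPrimitive {E : Type*} [Ring E] [Algebra K E]
    (X Y : WithConv (A ⊗[K] A →ₗ[K] E)) {g x : A}
    (hx : comul (R := K) x = x ⊗ₜ[K] 1 + g ⊗ₜ[K] x) (y : A) :
    (X * Y) (y ⊗ₜ x) = ∑ j ∈ (ℛ K y).index,
      (X ((ℛ K y).left j ⊗ₜ x) * Y ((ℛ K y).right j ⊗ₜ 1) +
        X ((ℛ K y).left j ⊗ₜ g) * Y ((ℛ K y).right j ⊗ₜ x)) := by
  let R : Coalgebra.Repr K x Bool :=
    ⟨Finset.univ, fun b => if b then x else g, fun b => if b then 1 else x, by simp [hx]⟩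
  rw [((ℛ K y).tmul R).convMul_apply]
  simp [Coalgebra.Repr.tmul, Finset.sum_product, R]

variable (γ : TwoCocycle K A)

/-- Evaluate `γ ∗ γ⁻¹ = ε` at `y ⊗ g`: the factor `γ(y₁ ⊗ g) = ε(y₁)` is absorbed by the counit
axiom. -/
theorem inv_tmul_grouplike {g : A} (hg : comul (R := K) g = g ⊗ₜ[K] g)
    (hγ : ∀ y, γ.toLinearMap (y ⊗ₜ g) = counit (R := K) y) (hε : counit (R := K) g = 1) (y : A) :
    γ.unit⁻¹.val (y ⊗ₜ g) = counit (R := K) y := by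
  have h := convMul_tmul_grouplike γ.unit.val γ.unit⁻¹.val hg y
  have h1 : ∀ a, γ.unit.val (a ⊗ₜ g) = counit (R := K) a := hγ
  rw [Units.mul_inv] at h
  simp only [h1] at h
  refine (sum_counit_left_smul_apply
    (γ.unit⁻¹.val.ofConv ∘ₗ (TensorProduct.mk K A A).flip g) y).symm.trans (h.symm.trans ?_)
  change algebraMap K K (counit (y ⊗ₜ[K] g)) = _
  simp [hε]

/-- At `y ⊗ x` the identity `γ ∗ γ⁻¹ = ε` collapses to `γ(y ⊗ x) + γ⁻¹(y ⊗ x) = ε(y) ε(x) = 0`. -/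
theorem inv_tmul_skewPrimitive {g x : A} (hx : comul (R := K) x = x ⊗ₜ[K] 1 + g ⊗ₜ[K] x)
    (hγ : ∀ y, γ.toLinearMap (y ⊗ₜ g) = counit (R := K) y) (hε : counit (R := K) x = 0) (y : A) :
    γ.unit⁻¹.val (y ⊗ₜ x) = -γ.toLinearMap (y ⊗ₜ x) := by
  have h := convMul_tmul_skewPrimitive γ.unit.val γ.unit⁻¹.val hx y
  have h1 : ∀ a, γ.unit.val (a ⊗ₜ g) = counit (R := K) a := hγ
  have h2 := fun a => γ.inv_tmul_grouplike (g := 1)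
    (by rw [Bialgebra.comul_one, Algebra.TensorProduct.one_def]) γ.map_tmul_one
    Bialgebra.counit_one a
  rw [Units.mul_inv] at h
  simp only [h1, h2, Finset.sum_add_distrib] at h
  have e1 := sum_counit_left_smul_apply
    (γ.unit⁻¹.val.ofConv ∘ₗ (TensorProduct.mk K A A).flip x) y
  have e2 := sum_counit_right_smul_apply
    (γ.unit.val.ofConv ∘ₗ (TensorProduct.mk K A A).flip x) y
  have e3 : (1 : WithConv (A ⊗[K] A →ₗ[K] K)) (y ⊗ₜ x) = 0 := by
    change algebraMap K K (counit (y ⊗ₜ[K] x)) = _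
    simp [hε]
  rw [e3] at h
  refine eq_neg_of_add_eq_zero_right (Eq.trans ?_ h.symm)
  refine congrArg₂ (· + ·) (e2.symm.trans ?_) e1.symm
  exact Finset.sum_congr rfl fun j _ => mul_comm _ _

theorem scal_convMul_mul_tmul_grouplike {g : A} (hg : comul (R := K) g = g ⊗ₜ[K] g)
    (hγ : ∀ y, γ.toLinearMap (y ⊗ₜ g) = counit (R := K) y) (y : A) :
    (scal _ A γ.unit.val * toConv (LinearMap.mul' K A)) (y ⊗ₜ g) = y * g := by
  rw [convMul_tmul_grouplike _ _ hg]
  refine Eq.trans ?_ (sum_counit_left_smul_apply (LinearMap.mulRight K g) y)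
  refine Finset.sum_congr rfl fun j _ => ?_
  change algebraMap K A (γ.toLinearMap (_ ⊗ₜ g)) * (_ * g) = _ • (_ * g)
  rw [hγ, Algebra.smul_def]

theorem twistedMul_tmul_grouplike {g : A} (hg : comul (R := K) g = g ⊗ₜ[K] g)
    (hγ : ∀ y, γ.toLinearMap (y ⊗ₜ g) = counit (R := K) y) (hε : counit (R := K) g = 1) (y : A) :
    γ.twistedMul (y ⊗ₜ g) = y * g := by
  refine (convMul_tmul_grouplike (scal _ A γ.unit.val * toConv (LinearMap.mul' K A))
    (scal _ A γ.unit⁻¹.val) hg y).trans ?_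
  refine Eq.trans ?_ (sum_counit_right_smul_apply (LinearMap.mulRight K g) y)
  refine Finset.sum_congr rfl fun j _ => ?_
  rw [γ.scal_convMul_mul_tmul_grouplike hg hγ]
  change _ * algebraMap K A (γ.unit⁻¹.val (_ ⊗ₜ g)) = _ • (_ * g)
  rw [γ.inv_tmul_grouplike hg hγ hε, ← Algebra.commutes, Algebra.smul_def]

/-- For `Δ(x) = x ⊗ 1 + g ⊗ x`, the twisted product `y · x` is
`yx + γ(y₁ ⊗ x) y₂ - γ(y₂ ⊗ x) y₁ g`. -/
theorem twistedMul_tmul_skewPrimitive_eq_sum {g x : A} (hg : comul (R := K) g = g ⊗ₜ[K] g)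
    (hx : comul (R := K) x = x ⊗ₜ[K] 1 + g ⊗ₜ[K] x)
    (hγ : ∀ y, γ.toLinearMap (y ⊗ₜ g) = counit (R := K) y) (hε : counit (R := K) x = 0) (y : A) :
    γ.twistedMul (y ⊗ₜ x) = y * x +
      ∑ j ∈ (ℛ K y).index, γ.toLinearMap ((ℛ K y).left j ⊗ₜ x) • (ℛ K y).right j -
      ∑ j ∈ (ℛ K y).index, γ.toLinearMap ((ℛ K y).right j ⊗ₜ x) • ((ℛ K y).left j * g) := by
  -- Associate as `(γ ∗ m) ∗ γ⁻¹`: the inner product yields the positive correction, and the outer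
  -- factor the negative one through `γ⁻¹(y ⊗ x) = -γ(y ⊗ x)`.
  let Z := scal _ A γ.unit.val * toConv (LinearMap.mul' K A)
  have hZ : Z (y ⊗ₜ x) = y * x +
      ∑ j ∈ (ℛ K y).index, γ.toLinearMap ((ℛ K y).left j ⊗ₜ x) • (ℛ K y).right j := by
    refine (convMul_tmul_skewPrimitive (scal _ A γ.unit.val) (toConv (LinearMap.mul' K A))
      hx y).trans ?_
    rw [Finset.sum_add_distrib, add_comm]
    refine congrArg₂ (· + ·)
      (Eq.trans ?_ (sum_counit_left_smul_apply (LinearMap.mulRight K x) y)) ?_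
    · refine Finset.sum_congr rfl fun j _ => ?_
      change algebraMap K A (γ.toLinearMap (_ ⊗ₜ g)) * (_ * x) = _ • (_ * x)
      rw [hγ, Algebra.smul_def]
    · refine Finset.sum_congr rfl fun j _ => ?_
      change algebraMap K A (γ.toLinearMap (_ ⊗ₜ x)) * (_ * 1) = _
      rw [mul_one, Algebra.smul_def]
  refine (convMul_tmul_skewPrimitive Z (scal _ A γ.unit⁻¹.val) hx y).trans ?_
  rw [Finset.sum_add_distrib, sub_eq_add_neg, ← hZ, ← Finset.sum_neg_distrib]
  refine congrArg₂ (· + ·) (Eq.trans ?_ (sum_counit_right_smul_apply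
    (Z.ofConv ∘ₗ (TensorProduct.mk K A A).flip x) y)) ?_
  · refine Finset.sum_congr rfl fun j _ => ?_
    change Z (_ ⊗ₜ x) * algebraMap K A (γ.unit⁻¹.val (_ ⊗ₜ 1)) = _ • Z (_ ⊗ₜ x)
    rw [γ.inv_tmul_grouplike (by rw [Bialgebra.comul_one, Algebra.TensorProduct.one_def])
      γ.map_tmul_one Bialgebra.counit_one, ← Algebra.commutes, Algebra.smul_def]
  · refine Finset.sum_congr rfl fun j _ => ?_
    rw [γ.scal_convMul_mul_tmul_grouplike hg hγ]
    change _ * algebraMap K A (γ.unit⁻¹.val (_ ⊗ₜ x)) = _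
    rw [γ.inv_tmul_skewPrimitive hx hγ hε, ← Algebra.commutes, ← Algebra.smul_def, neg_smul]

/-- The linear map `a ⊗ b ↦ γ(a ⊗ x) b`. -/
def contractLeft (x : A) : A ⊗[K] A →ₗ[K] A :=
  TensorProduct.lift
    (LinearMap.lsmul K A ∘ₗ γ.toLinearMap ∘ₗ (TensorProduct.mk K A A).flip x)

/-- The linear map `a ⊗ b ↦ γ(b ⊗ x) a g`. -/
def contractRight (x g : A) : A ⊗[K] A →ₗ[K] A :=
  TensorProduct.lift
    ((LinearMap.lsmul K A ∘ₗ γ.toLinearMap ∘ₗ (TensorProduct.mk K A A).flip x).flip ∘ₗ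
      LinearMap.mulRight K g)

theorem contractLeft_tmul (x a b : A) :
    γ.contractLeft x (a ⊗ₜ b) = γ.toLinearMap (a ⊗ₜ x) • b := rfl

theorem contractRight_tmul (x g a b : A) :
    γ.contractRight x g (a ⊗ₜ b) = γ.toLinearMap (b ⊗ₜ x) • (a * g) := rfl

/-- Writing the corrections as linear maps applied to `Δ(y)` frees them from the chosen
representative, so any formula for `Δ(y)` can be substituted. -/
theorem twistedMul_tmul_skewPrimitive {g x : A} (hg : comul (R := K) g = g ⊗ₜ[K] g)
    (hx : comul (R := K) x = x ⊗ₜ[K] 1 + g ⊗ₜ[K] x)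
    (hγ : ∀ y, γ.toLinearMap (y ⊗ₜ g) = counit (R := K) y) (hε : counit (R := K) x = 0) (y : A) :
    γ.twistedMul (y ⊗ₜ x) = y * x + γ.contractLeft x (comul y) - γ.contractRight x g (comul y) := by
  rw [γ.twistedMul_tmul_skewPrimitive_eq_sum hg hx hγ hε]
  conv_rhs => rw [← (ℛ K y).eq]
  simp only [map_sum, contractLeft_tmul, contractRight_tmul]

end TwoCocycle

namespace QuantumLinearSpace

variable {K Γ : Type*} [Field K] [CommGroup Γ] {θ : ℕ} (D : QuantumLinearSpace K Γ θ)

section Words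

open TensorBiproduct

/-! ### Words and straightening -/

/-- The word `x_{l₁} ⋯ x_{l_k}` in `T(W) # K[Γ]`. -/
def word (l : List (Fin θ)) : D.TensorBiproduct := (l.map (x D)).prod

theorem word_nil : D.word [] = 1 := rfl

theorem word_cons (i : Fin θ) (l : List (Fin θ)) : D.word (i :: l) = x D i * D.word l := by
  simp [word]

theorem word_append (l l' : List (Fin θ)) : D.word (l ++ l') = D.word l * D.word l' := by
  simp [word]

theorem word_replicate (n : ℕ) (i : Fin θ) : D.word (List.replicate n i) = x D i ^ n := by
  simp [word]

theorem x_mul_grp (h : Γ) (i : Fin θ) :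
    x D i * grp D h = ((D.χ i h)⁻¹ : Kˣ) • (grp D h * x D i) := by
  rw [grp_mul_x, Units.smul_def, smul_smul, ← Units.val_mul, inv_mul_cancel, Units.val_one,
    one_smul]

theorem word_mul_grp (l : List (Fin θ)) (h : Γ) :
    ∃ c : Kˣ, D.word l * grp D h = c • (grp D h * D.word l) := by
  induction l with
  | nil => exact ⟨1, by simp [word_nil]⟩
  | cons i l ih =>
    obtain ⟨c, hc⟩ := ih
    refine ⟨c * (D.χ i h)⁻¹, ?_⟩
    rw [word_cons, mul_assoc, hc, mul_smul_comm, ← mul_assoc, x_mul_grp, smul_mul_assoc, smul_smul,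
      mul_assoc]

section Straightening

variable {E : Type*} [Ring E] [Algebra K E] (π : D.TensorBiproduct →ₐ[K] E)

/-- The span of the images of the elements `h x_{l₁} ⋯ x_{l_m}` with `m < k`, with `h` in the
subgroup `H` and all indices `l_i < s`. -/
def wordSpan (H : Subgroup Γ) (s k : ℕ) : Submodule K E :=
  Submodule.span K {t | ∃ h ∈ H, ∃ l : List (Fin θ), (∀ j ∈ l, j.val < s) ∧ l.length < k ∧
    t = π (grp D h * D.word l)}

/-- The span of the images of the elements `h x₁^{n₁} ⋯ x_s^{n_s}` with `h` in the subgroup `H` and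
`n_j < r_j` for all `j`. -/
def monomialSpan (H : Subgroup Γ) (s : ℕ) : Submodule K E :=
  Submodule.span K {t | ∃ (h : Γ) (n : Fin θ → ℕ), h ∈ H ∧
    (∀ j : Fin θ, j.val < s → n j ≤ D.r j - 1) ∧ (∀ j : Fin θ, s ≤ j.val → n j = 0) ∧
    t = π (grp D h * (List.ofFn fun j => x D j ^ n j).prod)}

variable {D} {H : Subgroup Γ} {s : ℕ}

theorem mem_wordSpan {k : ℕ} {h : Γ} (hh : h ∈ H) {l : List (Fin θ)} (hl : ∀ j ∈ l, j.val < s)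
    (hk : l.length < k) : π (grp D h * D.word l) ∈ D.wordSpan π H s k :=
  Submodule.subset_span ⟨h, hh, l, hl, hk, rfl⟩

theorem wordSpan_mono {k k' : ℕ} (h : k ≤ k') : D.wordSpan π H s k ≤ D.wordSpan π H s k' :=
  Submodule.span_mono fun _ ⟨g, hg, l, hl, hk, ht⟩ => ⟨g, hg, l, hl, hk.trans_le h, ht⟩

/-- Moving `h` left past a word costs only a nonzero scalar, after which the words concatenate. -/
theorem mul_word_mem_wordSpan {k : ℕ} {t : E} (ht : t ∈ D.wordSpan π H s k) {h : Γ} (hh : h ∈ H)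
    {l : List (Fin θ)} (hl : ∀ j ∈ l, j.val < s) :
    t * π (grp D h * D.word l) ∈ D.wordSpan π H s (k + l.length) := by
  induction ht using Submodule.span_induction with
  | mem t ht =>
    obtain ⟨g, hg, m, hm, hk, rfl⟩ := ht
    obtain ⟨c, hc⟩ := D.word_mul_grp m h
    have : grp D g * D.word m * (grp D h * D.word l) =
        (c : K) • (grp D (g * h) * D.word (m ++ l)) := by
      rw [mul_assoc, ← mul_assoc (D.word m), hc, word_append, grp_mul, Units.smul_def]
      simp only [mul_assoc, smul_mul_assoc, mul_smul_comm]
    rw [← map_mul, this, map_smul]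
    refine Submodule.smul_mem _ _ (mem_wordSpan π (H.mul_mem hg hh) (fun j hj => ?_) ?_)
    · exact (List.mem_append.mp hj).elim (hm j) (hl j)
    · rw [List.length_append]; omega
  | zero => simp
  | add a b _ _ ha hb => rw [add_mul]; exact add_mem ha hb
  | smul c a _ ha => rw [smul_mul_assoc]; exact Submodule.smul_mem _ _ ha

theorem x_mul_mem_wordSpan {k : ℕ} {t : E} (ht : t ∈ D.wordSpan π H s k) {i : Fin θ}
    (hi : i.val < s) : π (x D i) * t ∈ D.wordSpan π H s (k + 1) := by
  induction ht using Submodule.span_induction with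
  | mem t ht =>
    obtain ⟨g, hg, m, hm, hk, rfl⟩ := ht
    have : x D i * (grp D g * D.word m) =
        (((D.χ i g)⁻¹ : Kˣ) : K) • (grp D g * D.word (i :: m)) := by
      rw [← mul_assoc, x_mul_grp, word_cons, Units.smul_def, smul_mul_assoc, mul_assoc]
    rw [← map_mul, this, map_smul]
    refine Submodule.smul_mem _ _ (mem_wordSpan π hg (fun j hj => ?_) ?_)
    · rcases List.mem_cons.mp hj with rfl | hj
      exacts [hi, hm j hj]
    · simpa using hk
  | zero => simp
  | add a b _ _ ha hb => rw [mul_add]; exact add_mem ha hb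
  | smul c a _ ha => rw [mul_smul_comm]; exact Submodule.smul_mem _ _ ha

theorem grp_mul_mem_wordSpan {k : ℕ} {t : E} (ht : t ∈ D.wordSpan π H s k) {h : Γ}
    (hh : h ∈ H) : π (grp D h) * t ∈ D.wordSpan π H s k := by
  induction ht using Submodule.span_induction with
  | mem t ht =>
    obtain ⟨g, hg, m, hm, hk, rfl⟩ := ht
    rw [← map_mul, ← mul_assoc, ← grp_mul]
    exact mem_wordSpan π (H.mul_mem hh hg) hm hk
  | zero => simp
  | add a b _ _ ha hb => rw [mul_add]; exact add_mem ha hb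
  | smul c a _ ha => rw [mul_smul_comm]; exact Submodule.smul_mem _ _ ha

theorem mul_mem_wordSpan {k k' : ℕ} {t t' : E} (ht : t ∈ D.wordSpan π H s k)
    (ht' : t' ∈ D.wordSpan π H s k') : t * t' ∈ D.wordSpan π H s (k + k') := by
  induction ht' using Submodule.span_induction with
  | mem t' ht' =>
    obtain ⟨g, hg, m, hm, hk, rfl⟩ := ht'
    exact wordSpan_mono π (by omega) (mul_word_mem_wordSpan π ht hg hm)
  | zero => simp
  | add a b _ _ ha hb => rw [mul_add]; exact add_mem ha hb
  | smul c a _ ha => rw [mul_smul_comm]; exact Submodule.smul_mem _ _ ha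

/-- The length bound in `wordSpan` is strict, so degree zero corresponds to index `1` and a single
generator to index `2`. -/
theorem grp_mem_wordSpan {h : Γ} (hh : h ∈ H) : π (grp D h) ∈ D.wordSpan π H s 1 := by
  have := mem_wordSpan π (D := D) (s := s) (k := 1) hh (l := []) (by simp) (by simp)
  rwa [word_nil, mul_one] at this

theorem x_mem_wordSpan {i : Fin θ} (hi : i.val < s) : π (x D i) ∈ D.wordSpan π H s 2 := by
  have := x_mul_mem_wordSpan π (grp_mem_wordSpan π H.one_mem) hi
  rwa [grp_one, map_one, mul_one] at this

theorem algebraMap_mem_wordSpan (c : K) : algebraMap K E c ∈ D.wordSpan π H s 1 := by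
  have := Submodule.smul_mem _ c (grp_mem_wordSpan (D := D) (s := s) π H.one_mem)
  rwa [grp_one, map_one, ← Algebra.algebraMap_eq_smul_one] at this

theorem exists_mem_wordSpan (t : D.TensorBiproduct) : ∃ k, π t ∈ D.wordSpan π ⊤ θ k := by
  obtain ⟨a, rfl⟩ := RingQuot.mkAlgHom_surjective K D.TensorRel t
  change ∃ k, π (TensorBiproduct.mk D a) ∈ _
  induction a using FreeAlgebra.induction with
  | grade0 c =>
    exact ⟨1, by rw [AlgHom.commutes, AlgHom.commutes]; exact algebraMap_mem_wordSpan π c⟩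
  | grade1 u =>
    cases u with
    | inl h => exact ⟨1, grp_mem_wordSpan π (Subgroup.mem_top h)⟩
    | inr i => exact ⟨2, x_mem_wordSpan π i.isLt⟩
  | mul a b ha hb =>
    obtain ⟨k, hk⟩ := ha
    obtain ⟨k', hk'⟩ := hb
    exact ⟨k + k', by rw [map_mul, map_mul]; exact mul_mem_wordSpan π hk hk'⟩
  | add a b ha hb =>
    obtain ⟨k, hk⟩ := ha
    obtain ⟨k', hk'⟩ := hb
    exact ⟨max k k', by
      rw [map_add, map_add]
      exact add_mem (wordSpan_mono π (le_max_left _ _) hk) (wordSpan_mono π (le_max_right _ _) hk')⟩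

/-- Permutations are generated by adjacent swaps. Each swap costs a scalar and an error of smaller
length, and multiplying by the remaining letters keeps the error shorter than the whole word. -/
theorem exists_sub_smul_word_mem_wordSpan
    (hlink : ∀ i j : Fin θ, i ≠ j → i.val < s → j.val < s →
      ∃ c : K, π (x D i * x D j) - c • π (x D j * x D i) ∈ D.wordSpan π H s 2)
    {l l' : List (Fin θ)} (hp : l.Perm l') (hl : ∀ j ∈ l, j.val < s) :
    ∃ c : K, π (D.word l) - c • π (D.word l') ∈ D.wordSpan π H s l.length := by
  induction hp with
  | nil => exact ⟨1, by simp⟩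
  | @cons i l l' _ ih =>
    obtain ⟨c, hc⟩ := ih fun j hj => hl j (List.mem_cons_of_mem _ hj)
    refine ⟨c, ?_⟩
    have := x_mul_mem_wordSpan π hc (hl i List.mem_cons_self)
    rw [word_cons, word_cons, map_mul, map_mul]
    rwa [mul_sub, mul_smul_comm] at this
  | swap i j l =>
    by_cases hij : i = j
    · subst hij
      exact ⟨1, by simp⟩
    · obtain ⟨c, hc⟩ := hlink j i (Ne.symm hij) (hl _ List.mem_cons_self)
        (hl _ (List.mem_cons_of_mem _ List.mem_cons_self))
      refine ⟨c, ?_⟩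
      have := mul_word_mem_wordSpan π hc H.one_mem (l := l) fun k hk =>
        hl k (List.mem_cons_of_mem _ (List.mem_cons_of_mem _ hk))
      rw [grp_one, one_mul, sub_mul, smul_mul_assoc, ← map_mul, ← map_mul] at this
      rw [word_cons, word_cons, word_cons, word_cons, ← mul_assoc, ← mul_assoc,
        show (j :: i :: l).length = 2 + l.length by simp only [List.length_cons]; omega]
      simpa using this
  | trans h₁ _ ih₁ ih₂ =>
    obtain ⟨c, hc⟩ := ih₁ hl
    obtain ⟨c', hc'⟩ := ih₂ fun j hj => hl j (h₁.mem_iff.mpr hj)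
    refine ⟨c * c', ?_⟩
    rw [← h₁.length_eq] at hc'
    have := add_mem hc (Submodule.smul_mem _ c hc')
    rwa [smul_sub, smul_smul, sub_add_sub_cancel] at this

theorem perm_flatten_replicate_count (l : List (Fin θ)) :
    l.Perm (List.ofFn fun j => List.replicate (l.count j) j).flatten := by
  rw [List.perm_iff_count]
  intro a
  rw [List.count_flatten, List.map_ofFn, List.sum_ofFn, Finset.sum_eq_single a]
  · simp
  · intro b _ hb
    simp [List.count_replicate, hb]
  · simp

theorem word_flatten_replicate (n : Fin θ → ℕ) :
    D.word (List.ofFn fun j => List.replicate (n j) j).flatten =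
      (List.ofFn fun j => x D j ^ n j).prod := by
  rw [word, List.map_flatten, List.prod_flatten, List.map_map, List.map_ofFn]
  congr 2
  funext j
  simp

/-- Straightening: if the `xᵢ` commute up to scalars and terms of lower degree, and `xᵢ^{rᵢ}` is of
lower degree, then every word is a combination of monomials `h x₁^{n₁} ⋯ x_s^{n_s}`, `nⱼ < rⱼ`. -/
theorem wordSpan_le_monomialSpan
    (hlink : ∀ i j : Fin θ, i ≠ j → i.val < s → j.val < s →
      ∃ c : K, π (x D i * x D j) - c • π (x D j * x D i) ∈ D.wordSpan π H s 2)
    (hpow : ∀ i : Fin θ, i.val < s → π (x D i ^ D.r i) ∈ D.wordSpan π H s (D.r i)) (k : ℕ) :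
    D.wordSpan π H s k ≤ D.monomialSpan π H s := by
  induction k with
  | zero => exact Submodule.span_le.mpr fun t ⟨_, _, _, _, hk, _⟩ => absurd hk (Nat.not_lt_zero _)
  | succ k ih =>
    refine Submodule.span_le.mpr ?_
    rintro _ ⟨h, hh, l, hl, hk, rfl⟩
    -- If every multiplicity is below `r_j`, sorting the letters gives an allowed monomial modulo
    -- shorter words.
    by_cases hr : ∀ j, l.count j < D.r j
    · obtain ⟨c, hc⟩ := exists_sub_smul_word_mem_wordSpan π hlink
        (perm_flatten_replicate_count l) hl
      rw [word_flatten_replicate] at hc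
      have h1 := ih (wordSpan_mono π (Nat.lt_succ_iff.mp hk) (grp_mul_mem_wordSpan π hc hh))
      rw [mul_sub, mul_smul_comm, ← map_mul, ← map_mul] at h1
      refine (Submodule.sub_mem_iff_left _
        (Submodule.smul_mem _ c (Submodule.subset_span ?_))).mp h1
      refine ⟨h, fun j => l.count j, hh, fun j _ => Nat.le_sub_one_of_lt (hr j),
        fun j hj => ?_, rfl⟩
      exact List.count_eq_zero.mpr fun hm => absurd (hl j hm) (by omega)
    -- Otherwise some letter `i` occurs at least `r_i` times. Bringing `r_i` copies to the front
    -- exposes `x_i^{r_i}`, and the power relation makes the whole word a combination of shorter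
    -- ones.
    · push Not at hr
      obtain ⟨i, hi⟩ := hr
      have hil : i ∈ l :=
        List.count_pos_iff.mp ((Nat.zero_lt_two.trans_le (D.two_le_r i)).trans_le hi)
      obtain ⟨m, hm⟩ := (List.replicate_sublist_iff.mpr hi).exists_perm_append
      obtain ⟨c, hc⟩ := exists_sub_smul_word_mem_wordSpan π hlink hm hl
      have h2 : π (D.word (List.replicate (D.r i) i ++ m)) ∈ D.wordSpan π H s l.length := by
        have := mul_word_mem_wordSpan π (hpow i (hl i hil)) H.one_mem (l := m) fun j hj =>
          hl j (hm.mem_iff.mpr (List.mem_append_right _ hj))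
        rw [hm.length_eq, word_append, word_replicate, map_mul]
        rw [grp_one, one_mul] at this
        simpa using this
      have h3 : π (D.word l) ∈ D.wordSpan π H s l.length :=
        (Submodule.sub_mem_iff_left _ (Submodule.smul_mem _ c h2)).mp hc
      rw [map_mul]
      exact ih (wordSpan_mono π (Nat.lt_succ_iff.mp hk) (grp_mul_mem_wordSpan π h3 hh))

end Straightening

/-! ### The relations of the biproduct -/

theorem word_mul_grp_mem_degreeGeTwo {l : List (Fin θ)} (hl : 2 ≤ l.length) (h : Γ) :
    D.word l * grp D h ∈ D.degreeGeTwo :=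
  Submodule.subset_span ⟨l, h, hl, rfl⟩

theorem grp_mul_word_mem_degreeGeTwo {l : List (Fin θ)} (hl : 2 ≤ l.length) (h : Γ) :
    grp D h * D.word l ∈ D.degreeGeTwo := by
  obtain ⟨c, hc⟩ := D.word_mul_grp l h
  rw [← inv_smul_eq_iff, Units.smul_def] at hc
  rw [← hc]
  exact Submodule.smul_mem _ _ (D.word_mul_grp_mem_degreeGeTwo hl h)

theorem exists_mem_span_words (t : D.TensorBiproduct) :
    t ∈ Submodule.span K {t | ∃ (l : List (Fin θ)) (h : Γ), t = grp D h * D.word l} := by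
  obtain ⟨k, hk⟩ := exists_mem_wordSpan (AlgHom.id K D.TensorBiproduct) t
  refine Submodule.span_mono ?_ hk
  rintro _ ⟨h, _, l, _, _, rfl⟩
  exact ⟨l, h, rfl⟩

variable {D} in
theorem mul_mem_degreeGeTwo_right {t : D.TensorBiproduct} (u : D.TensorBiproduct)
    (ht : t ∈ D.degreeGeTwo) : t * u ∈ D.degreeGeTwo := by
  induction D.exists_mem_span_words u using Submodule.span_induction with
  | mem u hu =>
    obtain ⟨l, h, rfl⟩ := hu
    induction ht using Submodule.span_induction with
    | mem t ht =>
      obtain ⟨m, k, hm, rfl⟩ := ht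
      change D.word m * _ * _ ∈ _
      obtain ⟨c, hc⟩ := D.word_mul_grp m (k * h)
      rw [mul_assoc, ← mul_assoc (grp D k), ← grp_mul, ← mul_assoc, hc, smul_mul_assoc, mul_assoc,
        ← word_append, Units.smul_def]
      refine Submodule.smul_mem _ _ (D.grp_mul_word_mem_degreeGeTwo ?_ _)
      rw [List.length_append]; omega
    | zero => simp
    | add a b _ _ ha hb => rw [add_mul]; exact add_mem ha hb
    | smul c a _ ha => rw [smul_mul_assoc]; exact Submodule.smul_mem _ _ ha
  | zero => simp
  | add a b _ _ ha hb => rw [mul_add]; exact add_mem ha hb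
  | smul c a _ ha => rw [mul_smul_comm]; exact Submodule.smul_mem _ _ ha

variable {D} in
theorem mul_mem_degreeGeTwo_left {t : D.TensorBiproduct} (u : D.TensorBiproduct)
    (ht : t ∈ D.degreeGeTwo) : u * t ∈ D.degreeGeTwo := by
  induction D.exists_mem_span_words u using Submodule.span_induction with
  | mem u hu =>
    obtain ⟨l, h, rfl⟩ := hu
    induction ht using Submodule.span_induction with
    | mem t ht =>
      obtain ⟨m, k, hm, rfl⟩ := ht
      change _ * (D.word m * _) ∈ _
      rw [← mul_assoc, mul_assoc (grp D h), ← word_append]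
      refine mul_mem_degreeGeTwo_right _ (D.grp_mul_word_mem_degreeGeTwo ?_ _)
      rw [List.length_append]; omega
    | zero => simp
    | add a b _ _ ha hb => rw [mul_add]; exact add_mem ha hb
    | smul c a _ ha => rw [mul_smul_comm]; exact Submodule.smul_mem _ _ ha
  | zero => simp
  | add a b _ _ ha hb => rw [add_mul]; exact add_mem ha hb
  | smul c a _ ha => rw [smul_mul_assoc]; exact Submodule.smul_mem _ _ ha

/-- The scalars of the trivial lifting. -/
def zeroScalars : D.LiftingScalars where
  a _ := 0
  b _ _ := 0
  b_symm _ _ _ := by simp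
  g_pow_ne_one _ h := absurd rfl h
  χ_pow_eq_one _ h := absurd rfl h
  g_mul_g_ne_one _ _ _ h := absurd rfl h
  χ_mul_χ_eq_one _ _ _ h := absurd rfl h

/-- The homogeneous relators are skew primitive, so they generate a coideal; since `r_i ≥ 2`, it
lies in degrees at least two. Maximality of the Nichols ideal then gives the quantum linear space
relations in `A`. -/
theorem zeroScalars_ideal_le : D.zeroScalars.ideal ≤ D.nicholsIdeal := by
  refine le_sSup ⟨inferInstance, inferInstance, fun t ht => ?_⟩
  -- With the degree part packaged as a two-sided ideal, the inclusion need only be checked on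
  -- relators.
  let J : TwoSidedIdeal D.TensorBiproduct := TwoSidedIdeal.mk' D.degreeGeTwo (zero_mem _)
    (fun ha hb => add_mem ha hb) (fun ha => neg_mem ha) (fun hb => mul_mem_degreeGeTwo_left _ hb)
    (fun ha => mul_mem_degreeGeTwo_right _ ha)
  have hJ : ∀ u, u ∈ J ↔ u ∈ D.degreeGeTwo := fun u => TwoSidedIdeal.mem_mk' _ _ _ _ _ _ u
  have hle : TwoSidedIdeal.span {t | D.zeroScalars.Relator t} ≤ J := by
    refine TwoSidedIdeal.span_le.mpr fun u hu => (hJ u).mpr ?_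
    have hw : ∀ l : List (Fin θ), 2 ≤ l.length → D.word l ∈ D.degreeGeTwo := fun l hl => by
      have := D.word_mul_grp_mem_degreeGeTwo hl 1
      rwa [grp_one, mul_one] at this
    cases hu with
    | power i =>
      have := hw (List.replicate (D.r i) i) (by simpa using D.two_le_r i)
      rw [word_replicate] at this
      simpa [zeroScalars] using this
    | link i j h =>
      have h1 := hw [i, j] le_rfl
      have h2 := hw [j, i] le_rfl
      simp only [word_cons, word_nil, mul_one] at h1 h2
      simpa [zeroScalars] using sub_mem h1 (Submodule.smul_mem _ _ h2)
  exact (hJ t).mp (hle (TwoSidedIdeal.mem_asIdeal.mp ht))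

/-- An algebra map from `T(W) # K[Γ]` under which products of two generators `xᵢ` vanish is zero on
the defining ideal of the Nichols algebra. -/
theorem algHom_eq_zero_of_mem_nicholsIdeal {E : Type*} [Ring E] [Algebra K E]
    (f : D.TensorBiproduct →ₐ[K] E)
    (hf : ∀ i j, f (TensorBiproduct.x D i) * f (TensorBiproduct.x D j) = 0) :
    ∀ t ∈ D.nicholsIdeal, f t = 0 := by
  have hd : D.degreeGeTwo ≤ LinearMap.ker f.toLinearMap := by
    refine Submodule.span_le.mpr ?_
    rintro _ ⟨l, h, hl, rfl⟩
    match l, hl with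
    | i :: j :: l, _ => simp [← mul_assoc, hf]
  have hn : D.nicholsIdeal ≤ RingHom.ker f := sSup_le fun I hI t ht => hd (hI.2.2 ht)
  exact fun t ht => hn ht

namespace Biproduct

/-- The quotient map `T(W) # K[Γ] → B(W) # K[Γ]`. -/
def proj : D.TensorBiproduct →ₐ[K] D.Biproduct := Ideal.Quotient.mkₐ K D.nicholsIdeal

theorem proj_grp (h : Γ) : proj D (TensorBiproduct.grp D h) = grp D h := rfl

theorem proj_x (i : Fin θ) : proj D (TensorBiproduct.x D i) = x D i := rfl

theorem proj_surjective : Function.Surjective (proj D) := Ideal.Quotient.mkₐ_surjective K _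

theorem proj_monomial (h : Γ) (n : Fin θ → ℕ) :
    proj D (TensorBiproduct.grp D h * (List.ofFn fun j => TensorBiproduct.x D j ^ n j).prod) =
      grp D h * monomial D n := by
  rw [map_mul, proj_grp, map_list_prod, List.map_ofFn, monomial]
  simp [Function.comp_def, proj_x]

theorem grp_one : grp D 1 = 1 := by
  rw [← proj_grp, TensorBiproduct.grp_one, map_one]

theorem grp_mul (h k : Γ) : grp D (h * k) = grp D h * grp D k := by
  rw [← proj_grp, TensorBiproduct.grp_mul, map_mul]; rfl

theorem grp_pow (h : Γ) (n : ℕ) : grp D (h ^ n) = grp D h ^ n := by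
  induction n with
  | zero => simp [grp_one]
  | succ n ih => rw [pow_succ, grp_mul, ih, pow_succ]

theorem grp_mul_x (h : Γ) (i : Fin θ) : grp D h * x D i = (D.χ i h : K) • (x D i * grp D h) := by
  rw [← proj_grp, ← proj_x, ← map_mul, TensorBiproduct.grp_mul_x, map_smul, map_mul]

theorem x_mul_grp (h : Γ) (i : Fin θ) :
    x D i * grp D h = (D.χ i h : K)⁻¹ • (grp D h * x D i) := by
  rw [grp_mul_x, smul_smul, inv_mul_cancel₀ (Units.ne_zero _), one_smul]

theorem x_pow_r (i : Fin θ) : x D i ^ D.r i = 0 := by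
  have := D.zeroScalars_ideal_le (D.zeroScalars.relator_mem (.power i))
  have h := Ideal.Quotient.eq_zero_iff_mem.mpr this
  simp only [zeroScalars, zero_smul, sub_zero, map_pow] at h
  exact h

theorem x_mul_x (i j : Fin θ) (hij : i ≠ j) :
    x D i * x D j = (D.χ j (D.g i) : K) • (x D j * x D i) := by
  have := D.zeroScalars_ideal_le (D.zeroScalars.relator_mem (.link i j hij))
  have h := Ideal.Quotient.eq_zero_iff_mem.mpr this
  simp only [zeroScalars, zero_smul, add_zero] at h
  exact sub_eq_zero.mp h

theorem comul_grp (h : Γ) : comul (R := K) (grp D h) = grp D h ⊗ₜ[K] grp D h :=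
  (congrArg (TensorProduct.map _ _) (TensorBiproduct.comul_grp D h)).trans rfl

theorem comul_x (i : Fin θ) :
    comul (R := K) (x D i) = x D i ⊗ₜ[K] 1 + grp D (D.g i) ⊗ₜ[K] x D i :=
  (congrArg (TensorProduct.map _ _) (TensorBiproduct.comul_x D i)).trans
    ((map_add _ _ _).trans rfl)

theorem counit_grp (h : Γ) : counit (R := K) (grp D h) = 1 := TensorBiproduct.counit_grp D h

theorem counit_x (i : Fin θ) : counit (R := K) (x D i) = 0 := TensorBiproduct.counit_x D i

/-! ### Linear independence of the monomials -/

/-- An algebra map from `T(W) # K[Γ]` under which products of two `xᵢ` vanish factors through the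
biproduct. -/
def lift {E : Type*} [Ring E] [Algebra K E] (f : D.TensorBiproduct →ₐ[K] E)
    (hf : ∀ i j, f (TensorBiproduct.x D i) * f (TensorBiproduct.x D j) = 0) :
    D.Biproduct →ₐ[K] E :=
  Ideal.Quotient.liftₐ D.nicholsIdeal f (D.algHom_eq_zero_of_mem_nicholsIdeal f hf)

/-- The projection `B(W) # K[Γ] → K[Γ]`. -/
def toGroupAlgebra : D.Biproduct →ₐ[K] MonoidAlgebra K Γ :=
  lift D (TensorBiproduct.lift (fun h => MonoidAlgebra.of K Γ h) (fun _ => 0) (map_one _)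
    (map_mul _) (fun _ _ => by simp)) fun i j => by rw [lift_x, zero_mul]

theorem toGroupAlgebra_grp (h : Γ) : toGroupAlgebra D (grp D h) = MonoidAlgebra.of K Γ h :=
  lift_grp ..

theorem toGroupAlgebra_x (i : Fin θ) : toGroupAlgebra D (x D i) = 0 :=
  lift_x ..

/-- The representation `h ↦ diag(χᵢ(h), 1)`, `xᵢ ↦ E₁₂`, `xⱼ ↦ 0` for `j ≠ i`. -/
def matrixRep (i : Fin θ) : D.Biproduct →ₐ[K] Matrix (Fin 2) (Fin 2) K :=
  lift D (TensorBiproduct.lift (fun h => !![(D.χ i h : K), 0; 0, 1])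
    (fun j => !![0, if j = i then 1 else 0; 0, 0])
    (by simp [Matrix.one_fin_two]) (fun _ _ => by simp) (fun h j => by
      by_cases hj : j = i <;> simp [hj])) fun j k => by
      ext a b
      by_cases hj : j = i <;> fin_cases a <;> fin_cases b <;> simp [lift_x, hj]

theorem matrixRep_grp (i : Fin θ) (h : Γ) :
    matrixRep D i (grp D h) = !![(D.χ i h : K), 0; 0, 1] :=
  lift_grp ..

theorem matrixRep_x (i j : Fin θ) :
    matrixRep D i (x D j) = !![0, if j = i then 1 else 0; 0, 0] :=
  lift_x ..

/-! ### Skew derivations of ordered monomials -/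

/-- The composite of `Δ` with the representation `matrixRep i` on the second factor; its upper right
entry is a skew derivation. -/
def comulMatrix (i : Fin θ) : D.Biproduct →ₐ[K] Matrix (Fin 2) (Fin 2) D.Biproduct :=
  ((matrixEquivTensor (Fin 2) K D.Biproduct).symm.toAlgHom.comp
    (Algebra.TensorProduct.map (AlgHom.id K _) (matrixRep D i))).comp
    (Bialgebra.comulAlgHom K D.Biproduct)

theorem comulMatrix_grp (i : Fin θ) (h : Γ) :
    comulMatrix D i (grp D h) = !![(D.χ i h : K) • grp D h, 0; 0, grp D h] := by
  change (matrixEquivTensor (Fin 2) K D.Biproduct).symm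
    (TensorProduct.map _ _ (comul (R := K) (grp D h))) = _
  rw [comul_grp, TensorProduct.map_tmul]
  change (matrixEquivTensor (Fin 2) K D.Biproduct).symm (grp D h ⊗ₜ matrixRep D i (grp D h)) = _
  rw [matrixEquivTensor_apply_symm, matrixRep_grp]
  ext a b
  fin_cases a <;> fin_cases b <;> simp [← Algebra.commutes, Algebra.smul_def]

theorem comulMatrix_x (i j : Fin θ) :
    comulMatrix D i (x D j) = !![x D j, if j = i then grp D (D.g i) else 0; 0, x D j] := by
  change (matrixEquivTensor (Fin 2) K D.Biproduct).symm
    (TensorProduct.map _ _ (comul (R := K) (x D j))) = _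
  rw [comul_x, map_add, TensorProduct.map_tmul, TensorProduct.map_tmul]
  change (matrixEquivTensor (Fin 2) K D.Biproduct).symm
    (x D j ⊗ₜ matrixRep D i 1 + grp D (D.g j) ⊗ₜ matrixRep D i (x D j)) = _
  rw [map_add, matrixEquivTensor_apply_symm, matrixEquivTensor_apply_symm, matrixRep_x, map_one]
  ext a b
  by_cases hj : j = i
  · subst hj
    fin_cases a <;> fin_cases b <;> simp
  · fin_cases a <;> fin_cases b <;> simp [hj]

/-- The product of the `xⱼ^{nⱼ}` over a list of indices. -/
def partialMonomial (L : List (Fin θ)) (n : Fin θ → ℕ) : D.Biproduct :=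
  (L.map fun j => x D j ^ n j).prod

theorem partialMonomial_finRange (n : Fin θ → ℕ) :
    partialMonomial D (List.finRange θ) n = monomial D n := by
  rw [partialMonomial, monomial, List.ofFn_eq_map]

theorem partialMonomial_cons (i : Fin θ) (L : List (Fin θ)) (n : Fin θ → ℕ) :
    partialMonomial D (i :: L) n = x D i ^ n i * partialMonomial D L n := by
  simp [partialMonomial]

theorem partialMonomial_update {i : Fin θ} {L : List (Fin θ)} (hi : i ∉ L) (n : Fin θ → ℕ) (m : ℕ) :
    partialMonomial D L (Function.update n i m) = partialMonomial D L n := by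
  rw [partialMonomial, partialMonomial]
  congr 1
  refine List.map_congr_left fun j hj => ?_
  rw [Function.update_of_ne (by rintro rfl; exact hi hj)]

theorem x_pow_mul_grp (i : Fin θ) (n : ℕ) (h : Γ) :
    x D i ^ n * grp D h = ((D.χ i h : K)⁻¹ ^ n) • (grp D h * x D i ^ n) := by
  induction n with
  | zero => simp
  | succ n ih =>
    rw [pow_succ, mul_assoc, x_mul_grp, mul_smul_comm, ← mul_assoc, ih, smul_mul_assoc, smul_smul,
      mul_assoc, ← pow_succ, ← pow_succ']

/-- The upper right entry sums over the position at which `g_i` replaces a factor `x_i`; moving it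
to the front past `k` factors costs `χ_i(g_i)^{-k}`. The truncated `n - 1` is harmless at `n = 0`,
where the sum is empty. -/
theorem comulMatrix_x_pow_self (i : Fin θ) (n : ℕ) :
    comulMatrix D i (x D i ^ n) = !![x D i ^ n, (∑ k ∈ Finset.range n, (D.χ i (D.g i) : K)⁻¹ ^ k) •
      (grp D (D.g i) * x D i ^ (n - 1)); 0, x D i ^ n] := by
  induction n with
  | zero => simp [Matrix.one_fin_two]
  | succ n ih =>
    have key : x D i * ((∑ k ∈ Finset.range n, (D.χ i (D.g i) : K)⁻¹ ^ k) •
        (grp D (D.g i) * x D i ^ (n - 1))) + grp D (D.g i) * x D i ^ n =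
        (∑ k ∈ Finset.range (n + 1), (D.χ i (D.g i) : K)⁻¹ ^ k) • (grp D (D.g i) * x D i ^ n) := by
      rw [Finset.sum_range_succ', pow_zero, add_smul, one_smul, mul_smul_comm, ← mul_assoc,
        x_mul_grp, smul_mul_assoc, smul_smul, mul_assoc]
      cases n with
      | zero => simp
      | succ n =>
        rw [Nat.add_sub_cancel, ← pow_succ', Finset.sum_mul]
        simp only [pow_succ]
    rw [pow_succ' (x D i), map_mul, ih, comulMatrix_x, if_pos rfl, Matrix.mul_fin_two, key]
    simp

/-- Multiplied by `q⁻¹ - 1`, with `q = χ_i(g_i)`, the sum becomes `q⁻ⁿ - 1`, which is nonzero for `0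
< n < r_i` because `q` is a primitive `r_i`-th root of unity. -/
theorem geom_sum_ne_zero_iff (i : Fin θ) {n : ℕ} (hn : n < D.r i) :
    ∑ k ∈ Finset.range n, (D.χ i (D.g i) : K)⁻¹ ^ k ≠ 0 ↔ n ≠ 0 := by
  refine ⟨fun h hn => h (by simp [hn]), fun h0 h => ?_⟩
  have := geom_sum_mul ((D.χ i (D.g i) : K)⁻¹) n
  rw [h, zero_mul] at this
  exact (D.isPrimitiveRoot i).inv.pow_ne_one_of_pos_of_lt h0 hn (sub_eq_zero.mp this.symm)

theorem comulMatrix_x_pow_of_ne {i j : Fin θ} (hj : j ≠ i) (n : ℕ) :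
    comulMatrix D i (x D j ^ n) = !![x D j ^ n, 0; 0, x D j ^ n] := by
  induction n with
  | zero => simp [Matrix.one_fin_two]
  | succ n ih => simp [pow_succ, ih, comulMatrix_x, hj]

/-- The matrices of `x_j` with `j ≠ i` are diagonal, and `i` occurs at most once in the list, so
only the factor `x_i^{n_i}` is differentiated. Moving `g_i` to the front contributes only nonzero
scalars. -/
theorem comulMatrix_partialMonomial {i : Fin θ} {L : List (Fin θ)} (hL : L.Nodup)
    {n : Fin θ → ℕ} (hn : n i < D.r i) :
    ∃ c : K, (c ≠ 0 ↔ i ∈ L ∧ n i ≠ 0) ∧ comulMatrix D i (partialMonomial D L n) =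
      !![partialMonomial D L n,
        c • (grp D (D.g i) * partialMonomial D L (Function.update n i (n i - 1)));
        0, partialMonomial D L n] := by
  induction L with
  | nil => exact ⟨0, by simp, by simp [partialMonomial, Matrix.one_fin_two]⟩
  | cons j L ih =>
    obtain ⟨hj, hL⟩ := List.nodup_cons.mp hL
    obtain ⟨c, hc, h⟩ := ih hL
    by_cases hji : j = i
    · subst hji
      -- The index `i` is absent from the tail, so the tail has no off-diagonal entry.
      have hc0 : c = 0 := by
        by_contra h0
        exact hj (hc.mp h0).1
      refine ⟨_, (geom_sum_ne_zero_iff D j hn).trans (by simp), ?_⟩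
      rw [partialMonomial_cons, partialMonomial_cons, map_mul, h, comulMatrix_x_pow_self, hc0,
        partialMonomial_update D hj]
      simp [mul_assoc]
    · refine ⟨c * (D.χ j (D.g i) : K)⁻¹ ^ n j, ?_, ?_⟩
      · rw [mul_ne_zero_iff_right (pow_ne_zero _ (inv_ne_zero (Units.ne_zero _))), hc]
        simp [Ne.symm hji]
      · rw [partialMonomial_cons, partialMonomial_cons, map_mul, h, comulMatrix_x_pow_of_ne D hji,
          Function.update_of_ne hji]
        simp [← mul_assoc, x_pow_mul_grp, smul_smul]

/-- The skew derivation attached to `xᵢ`. -/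
def skewDer (i : Fin θ) : D.Biproduct →ₗ[K] D.Biproduct :=
  Matrix.entryLinearMap K D.Biproduct 0 1 ∘ₗ (comulMatrix D i).toLinearMap

theorem skewDer_grp_mul_monomial (i : Fin θ) (h : Γ) {n : Fin θ → ℕ} (hn : n i < D.r i) :
    ∃ c : K, (c ≠ 0 ↔ n i ≠ 0) ∧ skewDer D i (grp D h * monomial D n) =
      c • (grp D (h * D.g i) * monomial D (Function.update n i (n i - 1))) := by
  obtain ⟨c, hc, hm⟩ := comulMatrix_partialMonomial D (List.nodup_finRange θ) hn
  refine ⟨(D.χ i h : K) * c, ?_, ?_⟩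
  · rw [mul_ne_zero_iff_left (Units.ne_zero _), hc]
    simp
  · rw [← partialMonomial_finRange, ← partialMonomial_finRange]
    change comulMatrix D i (_ * _) 0 1 = _
    rw [map_mul, hm, comulMatrix_grp]
    simp [grp_mul, smul_smul, mul_assoc]

theorem toGroupAlgebra_monomial {n : Fin θ → ℕ} (hn : n ≠ 0) :
    toGroupAlgebra D (monomial D n) = 0 := by
  obtain ⟨i, hi⟩ := Function.ne_iff.mp hn
  rw [monomial, map_list_prod, List.map_ofFn]
  exact List.prod_eq_zero (List.mem_ofFn.mpr ⟨i, by
    simp [toGroupAlgebra_x, zero_pow (show n i ≠ 0 from hi)]⟩)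

/-- Differentiate down to degree zero, project to `K[Γ]`, and read off a group coefficient. Only
vanishing or nonvanishing is recorded, which suffices for independence and avoids tracking scalars.
-/
theorem exists_dual_functional (N : ℕ) (h₀ : Γ) (n₀ : Fin θ → ℕ) (hN : ∑ j, n₀ j = N)
    (hn₀ : ∀ j, n₀ j < D.r j) : ∃ f : D.Biproduct →ₗ[K] K,
      ∀ (h : Γ) (n : Fin θ → ℕ), (∀ j, n j < D.r j) →
        (f (grp D h * monomial D n) ≠ 0 ↔ h = h₀ ∧ n = n₀) := by
  classical
  induction N generalizing h₀ n₀ with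
  | zero =>
    have h0 : n₀ = 0 := funext fun j => Finset.sum_eq_zero_iff.mp hN j (Finset.mem_univ j)
    subst h0
    refine ⟨Finsupp.lapply h₀ ∘ₗ (MonoidAlgebra.coeffLinearEquiv K).toLinearMap ∘ₗ
      (toGroupAlgebra D).toLinearMap, fun h n hn => ?_⟩
    by_cases h0 : n = 0
    · subst h0
      have h1 : monomial D (0 : Fin θ → ℕ) = 1 := by simp [monomial]
      rw [h1, mul_one]
      change (toGroupAlgebra D (grp D h)).coeff h₀ ≠ 0 ↔ _
      rw [toGroupAlgebra_grp]
      simp [Finsupp.single_apply]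
    · simp [toGroupAlgebra_monomial D h0, h0]
  | succ N ih =>
    obtain ⟨i, hi⟩ : ∃ i, n₀ i ≠ 0 := by
      by_contra! h
      simp [h] at hN
    -- The inductive target is the monomial to which the skew derivation sends the one indexed by
    -- `(h₀, n₀)`, up to a nonzero scalar.
    obtain ⟨f, hf⟩ := ih (h₀ * D.g i) (Function.update n₀ i (n₀ i - 1)) (by
      rw [Finset.sum_update_of_mem (Finset.mem_univ i)]
      rw [← Finset.add_sum_erase _ _ (Finset.mem_univ i)] at hN
      rw [Finset.sdiff_singleton_eq_erase]
      omega) (fun j => by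
        by_cases hj : j = i
        · subst hj; rw [Function.update_self]; have := hn₀ j; omega
        · rw [Function.update_of_ne hj]; exact hn₀ j)
    refine ⟨f ∘ₗ skewDer D i, fun h n hn => ?_⟩
    obtain ⟨c, hc, hd⟩ := skewDer_grp_mul_monomial D i h (hn i)
    rw [LinearMap.comp_apply, hd, map_smul, smul_eq_mul, mul_ne_zero_iff, hc, hf _ _ fun j => by
      by_cases hj : j = i
      · subst hj; rw [Function.update_self]; have := hn j; omega
      · rw [Function.update_of_ne hj]; exact hn j]
    rw [mul_left_inj]
    constructor
    -- Both `n i` and `n₀ i` are nonzero, so equality after truncated subtraction of one gives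
    -- equality before it.
    · rintro ⟨h1, h2, h3⟩
      refine ⟨h2, funext fun j => ?_⟩
      have := congrFun h3 j
      by_cases hj : j = i
      · subst hj; simp only [Function.update_self] at this; omega
      · simpa [Function.update_of_ne hj] using this
    · rintro ⟨rfl, rfl⟩
      exact ⟨hi, rfl, rfl⟩

/-- The monomials `h x₁^{n₁} ⋯ x_θ^{n_θ}` with `n_j < r_j` are linearly independent. -/
theorem linearIndependent_monomial :
    LinearIndependent K fun p : Γ × (∀ j, Fin (D.r j)) =>
      grp D p.1 * monomial D fun j => p.2 j := by
  rw [linearIndependent_iff']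
  intro s c hc p hp
  obtain ⟨f, hf⟩ := exists_dual_functional D _ p.1 (fun j => p.2 j) rfl fun j => (p.2 j).isLt
  have h := congrArg f hc
  rw [map_sum, map_zero, Finset.sum_eq_single p] at h
  · rw [map_smul, smul_eq_mul] at h
    exact (mul_eq_zero.mp h).resolve_right ((hf _ _ fun j => (p.2 j).isLt).mpr ⟨rfl, rfl⟩)
  · intro q _ hq
    have : f (grp D q.1 * monomial D fun j => q.2 j) = 0 := by
      by_contra h0
      obtain ⟨h1, h2⟩ := (hf _ _ fun j => (q.2 j).isLt).mp h0
      exact hq (Prod.ext h1 (funext fun j => Fin.ext (congrFun h2 j)))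
    rw [map_smul, this, smul_zero]
  · exact fun h => absurd hp h

end Biproduct

end Words

namespace Biproduct

/-! ### Spanning sets -/

/-- One inclusion is straightening, with vanishing error terms because the relations of `A` are
homogeneous. The other rebuilds each monomial from the generators. -/
theorem toSubmodule_initialSubalgebra [Finite Γ] (s : ℕ) :
    Subalgebra.toSubmodule (initialSubalgebra D s) =
      D.monomialSpan (proj D)
        (Subgroup.closure {k : Γ | ∃ j : Fin θ, j.val < s ∧ k = D.g j}) s := by
  set H := Subgroup.closure {k : Γ | ∃ j : Fin θ, j.val < s ∧ k = D.g j}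
  apply le_antisymm
  · intro t ht
    have h : ∃ k, t ∈ D.wordSpan (proj D) H s k := by
      replace ht : t ∈ initialSubalgebra D s := ht
      induction ht using Algebra.adjoin_induction with
      | mem t ht =>
        obtain ⟨j, hj, rfl | rfl⟩ := ht
        · exact ⟨2, x_mem_wordSpan (proj D) hj⟩
        · exact ⟨1, grp_mem_wordSpan (proj D) (Subgroup.subset_closure ⟨j, hj, rfl⟩)⟩
      | algebraMap c => exact ⟨1, algebraMap_mem_wordSpan (proj D) c⟩
      | add a b _ _ ha hb =>
        obtain ⟨k, hk⟩ := ha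
        obtain ⟨k', hk'⟩ := hb
        exact ⟨max k k', add_mem (wordSpan_mono _ (le_max_left _ _) hk)
          (wordSpan_mono _ (le_max_right _ _) hk')⟩
      | mul a b _ _ ha hb =>
        obtain ⟨k, hk⟩ := ha
        obtain ⟨k', hk'⟩ := hb
        exact ⟨k + k', mul_mem_wordSpan _ hk hk'⟩
    obtain ⟨k, hk⟩ := h
    refine wordSpan_le_monomialSpan (proj D) (fun i j hij _ _ => ⟨D.χ j (D.g i), ?_⟩)
      (fun i _ => ?_) k hk
    · rw [map_mul, map_mul, proj_x, proj_x, x_mul_x D i j hij, sub_self]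
      exact zero_mem _
    · rw [map_pow, proj_x, x_pow_r]
      exact zero_mem _
  · refine Submodule.span_le.mpr ?_
    rintro _ ⟨h, n, hh, _, hn, rfl⟩
    rw [proj_monomial]
    change _ ∈ initialSubalgebra D s
    refine mul_mem ?_ (Subalgebra.list_prod_mem _ fun t ht => ?_)
    · induction hh using Subgroup.closure_induction with
      | mem k hk =>
        obtain ⟨j, hj, rfl⟩ := hk
        exact Algebra.subset_adjoin ⟨j, hj, Or.inr rfl⟩
      | one => rw [grp_one]; exact one_mem _
      | mul a b _ _ ha hb => rw [grp_mul]; exact mul_mem ha hb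
      | inv a _ ha =>
        -- The algebra generators include the `g_j` but not their inverses; finiteness of `Γ` turns
        -- an inverse into a nonnegative power.
        have : a⁻¹ = a ^ (Nat.card Γ - 1) := by
          rw [inv_eq_iff_mul_eq_one, ← pow_succ', Nat.sub_add_cancel Nat.card_pos, pow_card_eq_one']
        rw [this, grp_pow]
        exact pow_mem ha _
    · obtain ⟨j, rfl⟩ := List.mem_ofFn.mp ht
      by_cases hj : j.val < s
      · have hx : x D j ∈ initialSubalgebra D s := Algebra.subset_adjoin ⟨j, hj, Or.inl rfl⟩
        exact pow_mem hx _
      · rw [hn j (not_lt.mp hj), pow_zero]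
        exact one_mem _

/-- Neither tensor leg of `Δ(t)` involves words longer than those in `t`. This crude filtration
bound controls the corrections in the twisted product. -/
theorem comul_mem_map₂_wordSpan {k : ℕ} {t : D.Biproduct} (ht : t ∈ D.wordSpan (proj D) ⊤ θ k) :
    comul (R := K) t ∈ Submodule.map₂ (TensorProduct.mk K D.Biproduct D.Biproduct)
      (D.wordSpan (proj D) ⊤ θ k) (D.wordSpan (proj D) ⊤ θ k) := by
  let F := D.wordSpan (proj D) ⊤ θ
  let Q : ℕ → Submodule K (D.Biproduct ⊗[K] D.Biproduct) := fun k =>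
    Submodule.map₂ (TensorProduct.mk K D.Biproduct D.Biproduct) (F k) (F k)
  have hQ : ∀ {a b : D.Biproduct} {m m' : ℕ}, (∀ t ∈ F m, a * t ∈ F m') →
      (∀ t ∈ F m, b * t ∈ F m') → ∀ u ∈ Q m, (a ⊗ₜ b) * u ∈ Q m' := by
    intro a b m m' ha hb
    have : Q m ≤ (Q m').comap (LinearMap.mulLeft K (a ⊗ₜ[K] b)) :=
      Submodule.map₂_le.mpr fun t ht u hu => by
        change (a ⊗ₜ[K] b) * (t ⊗ₜ[K] u) ∈ Q m'
        rw [Algebra.TensorProduct.tmul_mul_tmul]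
        exact Submodule.apply_mem_map₂ _ (ha t ht) (hb u hu)
    exact fun u hu => this hu
  have hQm : ∀ {m m'}, m ≤ m' → Q m ≤ Q m' := fun h =>
    Submodule.map₂_le_map₂ (wordSpan_mono _ h) (wordSpan_mono _ h)
  have hg : ∀ (h : Γ) (m) (t), t ∈ F m → grp D h * t ∈ F m := fun h m t ht =>
    grp_mul_mem_wordSpan (proj D) ht (Subgroup.mem_top h)
  have hx : ∀ (i : Fin θ) (m) (t), t ∈ F m → x D i * t ∈ F (m + 1) := fun i m t ht =>
    x_mul_mem_wordSpan (proj D) ht i.isLt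
  have hw : ∀ l : List (Fin θ), comul (R := K) (proj D (D.word l)) ∈ Q (l.length + 1) := by
    intro l
    induction l with
    | nil =>
      rw [word_nil, map_one, Bialgebra.comul_one, Algebra.TensorProduct.one_def]
      have := grp_mem_wordSpan (D := D) (s := θ) (proj D) (Subgroup.mem_top 1)
      rw [proj_grp, grp_one] at this
      exact Submodule.apply_mem_map₂ _ this this
    | cons i l ih =>
      rw [word_cons, map_mul, proj_x, Bialgebra.comul_mul, comul_x, add_mul]
      refine add_mem (hQ (hx i _) (fun t ht => ?_) _ ih) (hQ (fun t ht => ?_) (hx i _) _ ih)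
      · rw [one_mul]; exact wordSpan_mono _ (Nat.le_succ _) ht
      · exact wordSpan_mono _ (Nat.le_succ _) (hg _ _ _ ht)
  induction ht using Submodule.span_induction with
  | mem t ht =>
    obtain ⟨h, _, l, _, hl, rfl⟩ := ht
    rw [map_mul, Bialgebra.comul_mul, proj_grp, comul_grp]
    exact hQm hl (hQ (hg h _) (hg h _) _ (hw l))
  | zero => simp
  | add a b _ _ ha hb => rw [map_add]; exact add_mem ha hb
  | smul c a _ ha => rw [map_smul]; exact Submodule.smul_mem _ _ ha

theorem comul_x_pow (i : Fin θ) (n : ℕ) :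
    comul (R := K) (x D i ^ n) = ∑ k ∈ Finset.range (n + 1), qBinom (D.χ i (D.g i) : K) n k •
      ((x D i ^ k * grp D (D.g i) ^ (n - k)) ⊗ₜ[K] (x D i ^ (n - k))) := by
  rw [Bialgebra.comul_pow, comul_x, add_pow_eq_sum_qBinom (D.χ i (D.g i) : K)]
  · simp only [Algebra.TensorProduct.tmul_pow, Algebra.TensorProduct.tmul_mul_tmul, one_pow,
      one_mul]
  · simp only [Algebra.TensorProduct.tmul_mul_tmul, mul_one, one_mul, grp_mul_x,
      TensorProduct.smul_tmul']

end Biproduct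

namespace LiftingScalars

variable {D} (S : D.LiftingScalars)

/-- The inhomogeneous terms of the lifting relations lie in `K[Γ]`, hence are of lower length, and
straightening applies. No independence is claimed: only the upper bound on the dimension is needed.
-/
theorem span_lifting_eq_top : Submodule.span K (Set.range fun p : Γ × (∀ j, Fin (D.r j)) =>
    Ideal.Quotient.mkₐ K S.ideal
      (TensorBiproduct.grp D p.1 *
        (List.ofFn fun j => TensorBiproduct.x D j ^ (p.2 j).val).prod)) = ⊤ := by
  set π := Ideal.Quotient.mkₐ K S.ideal
  rw [eq_top_iff]
  intro t _
  obtain ⟨t, rfl⟩ := Ideal.Quotient.mkₐ_surjective K S.ideal t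
  obtain ⟨k, hk⟩ := exists_mem_wordSpan π t
  have hone : π 1 ∈ D.wordSpan π ⊤ θ 1 := by
    rw [← TensorBiproduct.grp_one]
    exact grp_mem_wordSpan π (Subgroup.mem_top 1)
  have hz : ∀ u, S.Relator u → π u = 0 := fun u hu =>
    Ideal.Quotient.eq_zero_iff_mem.mpr (S.relator_mem hu)
  have hm := wordSpan_le_monomialSpan π (H := ⊤) (s := θ)
    (fun i j hij _ _ => ⟨D.χ j (D.g i), by
      have := hz _ (.link i j hij)
      rw [map_sub, map_add, map_smul, map_smul, ← sub_sub, sub_eq_zero] at this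
      rw [this, map_sub]
      exact wordSpan_mono π one_le_two (Submodule.smul_mem _ _
        (sub_mem hone (grp_mem_wordSpan π (Subgroup.mem_top _))))⟩)
    (fun i _ => by
      have := hz _ (.power i)
      rw [map_sub, map_smul, sub_eq_zero] at this
      rw [this, map_sub]
      exact wordSpan_mono π (by have := D.two_le_r i; omega) (Submodule.smul_mem _ _
        (sub_mem hone (grp_mem_wordSpan π (Subgroup.mem_top _))))) k hk
  refine Submodule.span_le.mpr ?_ hm
  rintro _ ⟨h, n, _, hn, _, rfl⟩
  refine Submodule.subset_span ⟨(h, fun j => ⟨n j, ?_⟩), rfl⟩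
  have := hn j j.isLt
  have := D.two_le_r j
  omega

end LiftingScalars

variable {D}

open Biproduct

/-! ### The twist of the biproduct -/

section Twist

variable {γ : TwoCocycle K D.Biproduct} (hγ : γ.IsBilinearOver (groupSubalgebra D))
include hγ

theorem cocycle_tmul_grp (h : Γ) (y : D.Biproduct) :
    γ.toLinearMap (y ⊗ₜ grp D h) = counit (R := K) y := by
  have := hγ 1 (one_mem _) (grp D h) (Algebra.subset_adjoin ⟨h, rfl⟩) y 1
  rwa [one_mul, one_mul, γ.map_tmul_one, counit_grp, Bialgebra.counit_one, one_mul, one_mul] at this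

theorem cocycle_grp_mul_tmul (h : Γ) (y z : D.Biproduct) :
    γ.toLinearMap ((grp D h * y) ⊗ₜ z) = γ.toLinearMap (y ⊗ₜ z) := by
  have := hγ (grp D h) (Algebra.subset_adjoin ⟨h, rfl⟩) 1 (one_mem _) y z
  rwa [mul_one, counit_grp, Bialgebra.counit_one, one_mul, one_mul] at this

theorem cocycle_grp_tmul_x (h : Γ) (i : Fin θ) : γ.toLinearMap (grp D h ⊗ₜ x D i) = 0 := by
  have := cocycle_grp_mul_tmul hγ h 1 (x D i)
  rw [mul_one] at this
  rw [this, γ.map_one_tmul, counit_x]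

theorem twistedMul_tmul_grp (y : D.Biproduct) (h : Γ) :
    γ.twistedMul (y ⊗ₜ grp D h) = y * grp D h :=
  γ.twistedMul_tmul_grouplike (comul_grp D h) (cocycle_tmul_grp hγ h) (counit_grp D h) y

theorem twistedMul_tmul_x (y : D.Biproduct) (i : Fin θ) :
    γ.twistedMul (y ⊗ₜ x D i) = y * x D i + γ.contractLeft (x D i) (comul y) -
      γ.contractRight (x D i) (grp D (D.g i)) (comul y) :=
  γ.twistedMul_tmul_skewPrimitive (comul_grp D _) (comul_x D i) (cocycle_tmul_grp hγ _)
    (counit_x D i) y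

theorem twistedMul_grp_tmul_x (h : Γ) (i : Fin θ) :
    γ.twistedMul (grp D h ⊗ₜ x D i) = grp D h * x D i := by
  rw [twistedMul_tmul_x hγ, comul_grp, γ.contractLeft_tmul, γ.contractRight_tmul,
    cocycle_grp_tmul_x hγ]
  simp

/-- In each correction one term of `Δ(x_i)` survives: `x_i ⊗ 1` gives the `1`, and `g_i ⊗ x_i` gives
`g_i g_j`. -/
theorem twistedMul_x_tmul_x (i j : Fin θ) :
    γ.twistedMul (x D i ⊗ₜ x D j) = x D i * x D j +
      γ.toLinearMap (x D i ⊗ₜ x D j) • (1 - grp D (D.g i * D.g j)) := by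
  rw [twistedMul_tmul_x hγ, comul_x, map_add, map_add, γ.contractLeft_tmul, γ.contractRight_tmul,
    γ.contractLeft_tmul, γ.contractRight_tmul, cocycle_grp_tmul_x hγ, γ.map_one_tmul, counit_x,
    grp_mul]
  simp only [zero_smul, zero_add, add_zero, smul_sub]
  abel

/-- The algebra map `T(W) # K[Γ] → A^γ` fixing the generators. -/
def toTwistHom : D.TensorBiproduct →ₐ[K] γ.Twist :=
  TensorBiproduct.lift (fun h => γ.toTwist (grp D h)) (fun i => γ.toTwist (x D i))
    (by rw [grp_one, γ.toTwist_one])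
    (fun h k => by rw [γ.toTwist_mul_toTwist, twistedMul_tmul_grp hγ, grp_mul])
    (fun h i => by
      rw [γ.toTwist_mul_toTwist, γ.toTwist_mul_toTwist, twistedMul_tmul_grp hγ,
        twistedMul_grp_tmul_x hγ, grp_mul_x, map_smul])

theorem toTwistHom_grp (h : Γ) :
    toTwistHom hγ (TensorBiproduct.grp D h) = γ.toTwist (grp D h) :=
  TensorBiproduct.lift_grp ..

theorem toTwistHom_x (i : Fin θ) :
    toTwistHom hγ (TensorBiproduct.x D i) = γ.toTwist (x D i) :=
  TensorBiproduct.lift_x ..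

/-- The twisted product agrees with the original one up to shorter words, so every word is reached
by induction on its length. -/
theorem toTwist_mem_range {k : ℕ} {t : D.Biproduct} (ht : t ∈ D.wordSpan (proj D) ⊤ θ k) :
    γ.toTwist t ∈ (toTwistHom hγ).range := by
  induction k generalizing t with
  | zero =>
    induction ht using Submodule.span_induction with
    | mem t ht => obtain ⟨_, _, _, _, hk, _⟩ := ht; exact absurd hk (Nat.not_lt_zero _)
    | zero => rw [map_zero]; exact zero_mem _
    | add a b _ _ ha hb => rw [map_add]; exact add_mem ha hb
    | smul c a _ ha => rw [map_smul]; exact Subalgebra.smul_mem _ ha c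
  | succ k ih =>
    induction ht using Submodule.span_induction with
    | mem t ht =>
      obtain ⟨h, _, l, _, hl, rfl⟩ := ht
      -- The last letter is split off because the correction formula is for right multiplication by
      -- `x_i`.
      rcases List.eq_nil_or_concat l with rfl | ⟨m, i, rfl⟩
      · rw [word_nil, mul_one]
        exact ⟨_, toTwistHom_grp hγ h⟩
      · have hy := mem_wordSpan (proj D) (k := k) (Subgroup.mem_top h) (l := m)
          (fun j _ => j.isLt) (by simpa using hl)
        set y := proj D (TensorBiproduct.grp D h * D.word m) with hyd
        have hc := comul_mem_map₂_wordSpan D hy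
        have h1 : γ.contractLeft (x D i) (comul y) ∈ D.wordSpan (proj D) ⊤ θ k := by
          have hle : Submodule.map₂ (TensorProduct.mk K D.Biproduct D.Biproduct)
              (D.wordSpan (proj D) ⊤ θ k) (D.wordSpan (proj D) ⊤ θ k) ≤
              (D.wordSpan (proj D) ⊤ θ k).comap (γ.contractLeft (x D i)) :=
            Submodule.map₂_le.mpr fun a _ b hb => Submodule.smul_mem _ _ hb
          exact hle hc
        have h2 : γ.contractRight (x D i) (grp D (D.g i)) (comul y) ∈
            D.wordSpan (proj D) ⊤ θ k := by
          have hle : Submodule.map₂ (TensorProduct.mk K D.Biproduct D.Biproduct)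
              (D.wordSpan (proj D) ⊤ θ k) (D.wordSpan (proj D) ⊤ θ k) ≤
              (D.wordSpan (proj D) ⊤ θ k).comap (γ.contractRight (x D i) (grp D (D.g i))) :=
            Submodule.map₂_le.mpr fun a ha b _ => Submodule.smul_mem _ _ (by
              have := mul_word_mem_wordSpan (proj D) ha (Subgroup.mem_top (D.g i)) (l := [])
                (by simp)
              rwa [word_nil, mul_one] at this)
          exact hle hc
        -- The formula is solved for `y x_i`: the induction hypothesis covers `y` and both
        -- corrections.
        have h3 : proj D (TensorBiproduct.grp D h * D.word (m.concat i)) =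
            γ.twistedMul (y ⊗ₜ x D i) - γ.contractLeft (x D i) (comul y) +
              γ.contractRight (x D i) (grp D (D.g i)) (comul y) := by
          rw [twistedMul_tmul_x hγ, hyd, List.concat_eq_append, word_append, word_cons, word_nil,
            mul_one, ← mul_assoc, map_mul _ (_ * _), proj_x]
          abel
        rw [h3, map_add, map_sub, ← γ.toTwist_mul_toTwist]
        exact add_mem (sub_mem (mul_mem (ih hy) ⟨_, toTwistHom_x hγ i⟩) (ih h1)) (ih h2)
    | zero => rw [map_zero]; exact zero_mem _
    | add a b _ _ ha hb => rw [map_add]; exact add_mem ha hb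
    | smul c a _ ha => rw [map_smul]; exact Subalgebra.smul_mem _ ha c

theorem toTwistHom_surjective : Function.Surjective (toTwistHom hγ) := by
  intro t
  obtain ⟨t, rfl⟩ := γ.toTwist.surjective t
  obtain ⟨t, rfl⟩ := proj_surjective D t
  obtain ⟨k, hk⟩ := exists_mem_wordSpan (proj D) t
  exact toTwist_mem_range hγ hk

/-! ### Powers of a generator in the twist, and the lifting relations -/

theorem cocycle_x_pow_mul_grp_tmul (i : Fin θ) (k : ℕ) (h : Γ) (z : D.Biproduct) :
    γ.toLinearMap ((x D i ^ k * grp D h) ⊗ₜ z) =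
      (D.χ i h : K)⁻¹ ^ k * γ.toLinearMap ((x D i ^ k) ⊗ₜ z) := by
  rw [x_pow_mul_grp, ← TensorProduct.smul_tmul', map_smul, cocycle_grp_mul_tmul hγ, smul_eq_mul]

/-- Every leg of `Δ(x_i^n)` is some `x_i^k` times a group element with `k ≤ n`, and `γ(x_i^k ⊗ x_i)`
vanishes in this range. -/
theorem twistedMul_x_pow_tmul_x_of_lt {i : Fin θ}
    (h0 : ∀ n, n + 1 ≤ D.r i - 1 → γ.toLinearMap ((x D i ^ n) ⊗ₜ x D i) = 0) {n : ℕ}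
    (hn : n + 1 ≤ D.r i - 1) : γ.twistedMul ((x D i ^ n) ⊗ₜ x D i) = x D i ^ (n + 1) := by
  have hL : γ.contractLeft (x D i) (comul (x D i ^ n)) = 0 := by
    rw [comul_x_pow, map_sum]
    refine Finset.sum_eq_zero fun k hk => ?_
    have hk := Finset.mem_range.mp hk
    rw [map_smul, γ.contractLeft_tmul, ← grp_pow, cocycle_x_pow_mul_grp_tmul hγ, h0 k (by omega),
      mul_zero, zero_smul, smul_zero]
  have hR : γ.contractRight (x D i) (grp D (D.g i)) (comul (x D i ^ n)) = 0 := by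
    rw [comul_x_pow, map_sum]
    refine Finset.sum_eq_zero fun k hk => ?_
    rw [map_smul, γ.contractRight_tmul, h0 _ (by omega), zero_smul, smul_zero]
  rw [twistedMul_tmul_x hγ, hL, hR, add_zero, sub_zero, pow_succ]

/-- For exponent `r_i - 1` the left correction keeps only `x_i^{r_i-1} ⊗ 1` and the right one only
`g_i^{r_i-1} ⊗ x_i^{r_i-1}`, both with binomial coefficient one. The untwisted product `x_i^{r_i}`
is zero in `A`. -/
theorem twistedMul_x_pow_pred_tmul_x {i : Fin θ}
    (h0 : ∀ n, n + 1 ≤ D.r i - 1 → γ.toLinearMap ((x D i ^ n) ⊗ₜ x D i) = 0) :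
    γ.twistedMul ((x D i ^ (D.r i - 1)) ⊗ₜ x D i) =
      γ.toLinearMap ((x D i ^ (D.r i - 1)) ⊗ₜ x D i) • (1 - grp D (D.g i ^ D.r i)) := by
  have hr := D.two_le_r i
  have hL : γ.contractLeft (x D i) (comul (x D i ^ (D.r i - 1))) =
      γ.toLinearMap ((x D i ^ (D.r i - 1)) ⊗ₜ x D i) • 1 := by
    rw [comul_x_pow, map_sum, Finset.sum_eq_single (D.r i - 1)]
    · rw [qBinom_self, one_smul, γ.contractLeft_tmul, Nat.sub_self, pow_zero, pow_zero, mul_one]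
    · intro k hk hk'
      have hk := Finset.mem_range.mp hk
      rw [map_smul, γ.contractLeft_tmul, ← grp_pow, cocycle_x_pow_mul_grp_tmul hγ,
        h0 k (by omega), mul_zero, zero_smul, smul_zero]
    · simp
  have hR : γ.contractRight (x D i) (grp D (D.g i)) (comul (x D i ^ (D.r i - 1))) =
      γ.toLinearMap ((x D i ^ (D.r i - 1)) ⊗ₜ x D i) • grp D (D.g i ^ D.r i) := by
    rw [comul_x_pow, map_sum, Finset.sum_eq_single 0]
    · rw [qBinom_zero, one_smul, γ.contractRight_tmul, Nat.sub_zero, pow_zero, one_mul, ← pow_succ,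
        Nat.sub_add_cancel (by omega), grp_pow]
    · intro k hk hk'
      rw [map_smul, γ.contractRight_tmul, h0 _ (by omega), zero_smul, smul_zero]
    · simp
  rw [twistedMul_tmul_x hγ, hL, hR, ← pow_succ, Nat.sub_add_cancel (by omega), x_pow_r, zero_add,
    smul_sub]

theorem toTwist_x_pow {i : Fin θ}
    (h0 : ∀ n, n + 1 ≤ D.r i - 1 → γ.toLinearMap ((x D i ^ n) ⊗ₜ x D i) = 0) {n : ℕ}
    (hn : n ≤ D.r i - 1) : γ.toTwist (x D i) ^ n = γ.toTwist (x D i ^ n) := by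
  induction n with
  | zero => rw [pow_zero, pow_zero, γ.toTwist_one]
  | succ n ih =>
    rw [pow_succ, ih (by omega), γ.toTwist_mul_toTwist, twistedMul_x_pow_tmul_x_of_lt hγ h0 hn]

/-- The relations of the lifting hold in `A^γ`. -/
theorem toTwistHom_relator (S : D.LiftingScalars)
    (h1 : ∀ i n, n + 1 ≤ D.r i - 1 → γ.toLinearMap ((x D i ^ n) ⊗ₜ x D i) = 0)
    (h2 : ∀ i j, i < j → γ.toLinearMap (x D i ⊗ₜ x D j) = 0)
    (h3 : ∀ i, γ.toLinearMap ((x D i ^ (D.r i - 1)) ⊗ₜ x D i) = S.a i)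
    (h4 : ∀ i j, j < i → γ.toLinearMap (x D i ⊗ₜ x D j) = S.b i j)
    {t : D.TensorBiproduct} (ht : S.Relator t) : toTwistHom hγ t = 0 := by
  cases ht with
  | power i =>
    have hr := D.two_le_r i
    rw [map_sub, map_smul, map_sub, map_pow, map_one, toTwistHom_x, toTwistHom_grp, sub_eq_zero]
    -- Twisted and untwisted powers agree up to exponent `r_i - 1`, so only the last multiplication
    -- produces a correction.
    conv_lhs => rw [← Nat.sub_add_cancel (show 1 ≤ D.r i by omega), pow_succ]
    rw [toTwist_x_pow hγ (h1 i) le_rfl, γ.toTwist_mul_toTwist,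
      twistedMul_x_pow_pred_tmul_x hγ (h1 i), h3, map_smul, map_sub, γ.toTwist_one]
  | link i j hij =>
    rw [map_sub, map_add, map_smul, map_smul, map_sub, map_mul, map_mul, map_one, toTwistHom_x,
      toTwistHom_x, toTwistHom_grp, sub_eq_zero, γ.toTwist_mul_toTwist, γ.toTwist_mul_toTwist,
      twistedMul_x_tmul_x hγ, twistedMul_x_tmul_x hγ, ← γ.toTwist_one, ← map_sub, ← map_smul,
      ← map_smul, ← map_add, x_mul_x D i j hij]
    congr 1
    -- Only the pair with the larger index on the left can have a nonzero `γ`-value. For `i < j` the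
    -- required identity is `χ_j(g_i) a_{ji} + a_{ij} = 0`, which is the symmetry of the scalars.
    rcases lt_or_gt_of_ne hij with h | h
    · have hχ : (D.χ j (D.g i) : K) = (D.χ i (D.g j) : K)⁻¹ := by
        have := congrArg Units.val (D.χ_mul_χ i j hij)
        exact eq_inv_of_mul_eq_one_right (by simpa using this)
      rw [h2 i j h, h4 j i h, S.b_symm j i hij.symm, hχ, mul_comm (D.g j)]
      simp [smul_add, smul_smul]
    · rw [h2 j i h, h4 i j h]
      simp

/-! ### Comparison of the lifting with the twist -/

/-- The bialgebra map from the lifting to `A^γ` induced by `toTwistHom`. -/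
def liftingToTwist (S : D.LiftingScalars) (hS : ∀ t, S.Relator t → toTwistHom hγ t = 0) :
    S.Lifting →ₐc[K] γ.Twist :=
  BialgHom.ofAlgHom (Ideal.Quotient.liftₐ S.ideal (toTwistHom hγ) (S.ideal_le_ker _ hS))
    (Ideal.Quotient.algHom_ext K <| TensorBiproduct.algHom_ext
      (fun h => by
        change counit (R := K) (toTwistHom hγ (TensorBiproduct.grp D h)) =
          counit (R := K) (TensorBiproduct.grp D h)
        rw [toTwistHom_grp, TensorBiproduct.counit_grp]
        exact counit_grp D h)
      (fun i => by
        change counit (R := K) (toTwistHom hγ (TensorBiproduct.x D i)) =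
          counit (R := K) (TensorBiproduct.x D i)
        rw [toTwistHom_x, TensorBiproduct.counit_x]
        exact counit_x D i))
    (Ideal.Quotient.algHom_ext K <| TensorBiproduct.algHom_ext
      (fun h => by
        let ψ := (Ideal.Quotient.liftₐ S.ideal (toTwistHom hγ) (S.ideal_le_ker _ hS)).toLinearMap
        let p := (Ideal.Quotient.mkₐ K S.ideal).toLinearMap
        change TensorProduct.map ψ ψ (TensorProduct.map p p
          (comul (R := K) (TensorBiproduct.grp D h))) =
          comul (R := K) (toTwistHom hγ (TensorBiproduct.grp D h))
        rw [TensorBiproduct.comul_grp, toTwistHom_grp, TensorProduct.map_tmul,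
          TensorProduct.map_tmul]
        change toTwistHom hγ (TensorBiproduct.grp D h) ⊗ₜ
          toTwistHom hγ (TensorBiproduct.grp D h) = _
        rw [toTwistHom_grp]
        exact (comul_grp D h).symm)
      (fun i => by
        let ψ := (Ideal.Quotient.liftₐ S.ideal (toTwistHom hγ) (S.ideal_le_ker _ hS)).toLinearMap
        let p := (Ideal.Quotient.mkₐ K S.ideal).toLinearMap
        change TensorProduct.map ψ ψ (TensorProduct.map p p
          (comul (R := K) (TensorBiproduct.x D i))) =
          comul (R := K) (toTwistHom hγ (TensorBiproduct.x D i))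
        rw [TensorBiproduct.comul_x, toTwistHom_x, map_add, map_add, TensorProduct.map_tmul,
          TensorProduct.map_tmul, TensorProduct.map_tmul, TensorProduct.map_tmul]
        change toTwistHom hγ (TensorBiproduct.x D i) ⊗ₜ toTwistHom hγ 1 +
          toTwistHom hγ (TensorBiproduct.grp D (D.g i)) ⊗ₜ toTwistHom hγ (TensorBiproduct.x D i) = _
        rw [toTwistHom_grp, toTwistHom_x, map_one]
        exact (comul_x D i).symm))

theorem liftingToTwist_surjective (S : D.LiftingScalars)
    (hS : ∀ t, S.Relator t → toTwistHom hγ t = 0) :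
    Function.Surjective (liftingToTwist hγ S hS) := fun t => by
  obtain ⟨u, hu⟩ := toTwistHom_surjective hγ t
  exact ⟨Ideal.Quotient.mk _ u, hu⟩

/-- Dimensions are squeezed: `dim B ≤ |Γ| ∏ r_i ≤ dim A ≤ dim B`, by spanning, independence and
surjectivity respectively. -/
theorem liftingToTwist_bijective [Finite Γ] (S : D.LiftingScalars)
    (hS : ∀ t, S.Relator t → toTwistHom hγ t = 0) :
    Function.Bijective (liftingToTwist hγ S hS) := by
  have hsurj := liftingToTwist_surjective hγ S hS
  refine ⟨?_, hsurj⟩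
  have := Fintype.ofFinite Γ
  -- The twist has `A` as its underlying space, so the count can be made in `A`, where the
  -- independent monomials live.
  let f : S.Lifting →ₗ[K] D.Biproduct :=
    γ.toTwist.symm.toCoalgHom.toLinearMap ∘ₗ (liftingToTwist hγ S hS : S.Lifting →ₗ[K] γ.Twist)
  have hf : Function.Surjective f := γ.toTwist.symm.surjective.comp hsurj
  have hspan := S.span_lifting_eq_top
  have hB : Module.Finite K S.Lifting :=
    ⟨Submodule.fg_def.mpr ⟨_, Set.finite_range _, hspan⟩⟩
  have hA : Module.Finite K D.Biproduct := Module.Finite.of_surjective f hf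
  have h1 := (linearIndependent_monomial D).fintype_card_le_finrank
  have h2 := finrank_range_le_card (R := K) (fun p : Γ × (∀ j, Fin (D.r j)) =>
    Ideal.Quotient.mkₐ K S.ideal (TensorBiproduct.grp D p.1 *
      (List.ofFn fun j => TensorBiproduct.x D j ^ (p.2 j).val).prod))
  rw [Set.finrank, hspan, finrank_top] at h2
  have h3 := LinearMap.finrank_le_finrank_of_surjective hf
  have hinj : Function.Injective f :=
    (LinearMap.injective_iff_surjective_of_finrank_eq_finrank
      (le_antisymm (h2.trans h1) h3)).mpr hf
  exact fun a b hab => hinj (congrArg γ.toTwist.symm hab)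

end Twist

end QuantumLinearSpace

end

/-! ### The theorem -/

theorem mainTheorem7 {K : Type*} [Field K] [CharZero K] {Γ : Type*} [CommGroup Γ] [Finite Γ]
    {θ : ℕ} (D : QuantumLinearSpace K Γ θ) (S : D.LiftingScalars) :
    (∀ s : ℕ, 1 ≤ s → s < θ →
      Subalgebra.toSubmodule (QuantumLinearSpace.Biproduct.initialSubalgebra D s) =
        Submodule.span K {t : D.Biproduct | ∃ (h : Γ) (n : Fin θ → ℕ),
          h ∈ Subgroup.closure {k : Γ | ∃ j : Fin θ, j.val < s ∧ k = D.g j} ∧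
          (∀ j : Fin θ, j.val < s → n j ≤ D.r j - 1) ∧ (∀ j : Fin θ, s ≤ j.val → n j = 0) ∧
          t = QuantumLinearSpace.Biproduct.grp D h *
            QuantumLinearSpace.Biproduct.monomial D n}) ∧
    ∀ γ : TwoCocycle K D.Biproduct,
      γ.IsBilinearOver (QuantumLinearSpace.Biproduct.groupSubalgebra D) →
      (∀ (i : Fin θ) (n m : ℕ), n + m ≤ D.r i - 1 →
        γ.toLinearMap ((QuantumLinearSpace.Biproduct.x D i ^ n) ⊗ₜ
            (QuantumLinearSpace.Biproduct.x D i ^ m)) =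
          counit (R := K) (QuantumLinearSpace.Biproduct.x D i ^ n) *
            counit (R := K) (QuantumLinearSpace.Biproduct.x D i ^ m)) →
      (∀ s : Fin θ, 0 < s.val →
        ∀ z ∈ QuantumLinearSpace.Biproduct.initialSubalgebra D s.val,
        ∀ n : ℕ, n ≤ D.r s - 1 →
          γ.toLinearMap (z ⊗ₜ (QuantumLinearSpace.Biproduct.x D s ^ n)) =
            counit (R := K) z * counit (R := K) (QuantumLinearSpace.Biproduct.x D s ^ n)) →
      (∀ i : Fin θ,
        γ.toLinearMap ((QuantumLinearSpace.Biproduct.x D i ^ (D.r i - 1)) ⊗ₜ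
          QuantumLinearSpace.Biproduct.x D i) = S.a i) →
      (∀ i j : Fin θ, j < i →
        γ.toLinearMap (QuantumLinearSpace.Biproduct.x D i ⊗ₜ
          QuantumLinearSpace.Biproduct.x D j) = S.b i j) →
      Nonempty (γ.Twist ≃ₐc[K] S.Lifting) := by
  refine ⟨fun s _ _ => ?_, fun γ hγ h1 h2 h3 h4 => ?_⟩
  · rw [QuantumLinearSpace.Biproduct.toSubmodule_initialSubalgebra]
    simp only [QuantumLinearSpace.monomialSpan, QuantumLinearSpace.Biproduct.proj_monomial]
  · have hS := fun t (ht : S.Relator t) => QuantumLinearSpace.toTwistHom_relator hγ S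
      (fun i n hn => by
        have := h1 i n 1 hn
        rwa [pow_one, QuantumLinearSpace.Biproduct.counit_x, mul_zero] at this)
      (fun i j hij => by
        have hr := D.two_le_r j
        -- Indices start at zero, so the subalgebra at `j.val` is generated by the data strictly
        -- before `j` and contains `x_i`. The exponent `1` is allowed because `r_j ≥ 2`.
        have := h2 j (by have : i.val < j.val := hij; omega)
          (QuantumLinearSpace.Biproduct.x D i)
          (Algebra.subset_adjoin ⟨i, hij, Or.inl rfl⟩) 1 (by omega)
        rwa [pow_one, QuantumLinearSpace.Biproduct.counit_x, zero_mul] at this) h3 h4 ht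
    exact ⟨(BialgEquiv.ofBijective _
      (QuantumLinearSpace.liftingToTwist_bijective hγ S hS)).symm⟩
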